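/- Let $H$ be a complex Hilbert space (possibly infinite-dimensional), let $k$ be an integer, and suppose that $\dim H>2k>2$. Denote by $\mathcal G_k(H)$ the set of all $k$-dimensional linear subspaces of $H$. Two closed subspaces of $H$ are called compatible if there is an orthogonal basis of $H$ such that each of them is spanned (as a closed subspace) by a subset of this basis. Two elements $X,Y\in\mathcal G_k(H)$ are called adjacent if $\dim(X\cap Y)=k-1$, and ortho-adjacent if they are adjacent and compatible. Let $f:\mathcal G_k(H)\to\mathcal G_k(H)$ be a (not necessarily injective or surjective) map that preserves orthogonality, i.e. $f(X)\perp f(Y)$ whenever $X\perp Y$. Then the following two conditions are equivalent: (A) for any ortho-adjacent $X,Y\in\mathcal G_k(H)$ the images $f(X),f(Y)$ are ortho-adjacent; (B) for any adjacent $X,Y\in\mathcal G_k(H)$ the images $f(X),f(Y)$ are adjacent or $f(X)=f(Y)$. If one of these conditions holds, then $f$ is induced by a linear or conjugate-linear isometry of $H$ to itself, i.e. there is a linear or conjugate-linear map $L:H\to H$ with $\|Lx\|=\|x\|$ for all $x\in H$ such that $f(X)=L(X)$ for every $X\in\mathcal G_k(H)$. -/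

import Mathlib

namespace HilbertGrassmannian

/-- The Grassmannian of all `k`-dimensional linear subspaces of the complex Hilbert space `H`. -/
def Gr (k : ℕ) (H : Type*) [NormedAddCommGroup H] [InnerProductSpace ℂ H] : Type _ :=
  {X : Submodule ℂ H // FiniteDimensional ℂ X ∧ Module.finrank ℂ X = k}

section

variable {H : Type*} [NormedAddCommGroup H] [InnerProductSpace ℂ H]

/-- `B` is an orthogonal basis of `H` (in the Hilbert space sense): a family of non-zero,
mutually orthogonal vectors whose closed linear span is all of `H`. -/
def IsOrthogonalBasis (B : Set H) : Prop :=
  (0 : H) ∉ B ∧ (∀ x ∈ B, ∀ y ∈ B, x ≠ y → inner ℂ x y = 0) ∧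
    (Submodule.span ℂ B).topologicalClosure = ⊤

/-- Two (closed) subspaces are compatible if there is an orthogonal basis of `H` such that each of
them is the closed linear span of a subset of this basis. -/
def Compatible (X Y : Submodule ℂ H) : Prop :=
  ∃ B : Set H, IsOrthogonalBasis B ∧
    (∃ S ⊆ B, X = (Submodule.span ℂ S).topologicalClosure) ∧
    (∃ T ⊆ B, Y = (Submodule.span ℂ T).topologicalClosure)

variable {k : ℕ}

/-- Orthogonality of `k`-dimensional subspaces. -/
def Orthogonal (X Y : Gr k H) : Prop := X.1 ⟂ Y.1

/-- Two `k`-dimensional subspaces are adjacent if their intersection is `(k-1)`-dimensional. -/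
def Adjacent (X Y : Gr k H) : Prop :=
  Module.finrank ℂ (X.1 ⊓ Y.1 : Submodule ℂ H) + 1 = k

/-- Two `k`-dimensional subspaces are ortho-adjacent if they are adjacent and compatible. -/
def OrthoAdjacent (X Y : Gr k H) : Prop := Adjacent X Y ∧ Compatible X.1 Y.1

/-- `f` sends orthogonal `k`-dimensional subspaces to orthogonal ones. -/
def OrthogonalityPreserving (f : Gr k H → Gr k H) : Prop :=
  ∀ X Y : Gr k H, Orthogonal X Y → Orthogonal (f X) (f Y)

/-- `f` sends ortho-adjacent `k`-dimensional subspaces to ortho-adjacent ones. -/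
def OrthoAdjacencyPreserving (f : Gr k H → Gr k H) : Prop :=
  ∀ X Y : Gr k H, OrthoAdjacent X Y → OrthoAdjacent (f X) (f Y)

/-- `f` is induced by a linear isometry of `H` to itself: `f X` is the image of `X`. -/
def InducedByLinearIsometry (f : Gr k H → Gr k H) : Prop :=
  ∃ L : H →ₗᵢ[ℂ] H, ∀ X : Gr k H, (f X).1 = X.1.map L.toLinearMap

/-- `f` is induced by a conjugate-linear isometry of `H` to itself: `f X` is the image of `X`. -/
def InducedByConjLinearIsometry (f : Gr k H → Gr k H) : Prop :=
  ∃ L : H →ₛₗᵢ[starRingEnd ℂ] H, ∀ X : Gr k H, (f X).1 = X.1.map L.toLinearMap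

end

end HilbertGrassmannian

namespace HilbertGrassmannian

-- Dimension counts for subspaces and their orthogonal complements.

section Dimension

variable {H : Type*} [NormedAddCommGroup H] [InnerProductSpace ℂ H]

-- Both conditions imply the weaker property that ortho-adjacent subspaces go to adjacent or equal
-- ones. With orthogonality, this already forces `f` to come from a linear or conjugate-linear
-- isometry, and such an isometry preserves adjacency and ortho-adjacency; hence the equivalence.
--
-- Descent. Let `S` have dimension k-1 and let `a`, `b`, `c` be pairwise orthogonal non-zero vectors
-- of `Sᗮ`. The images of S+a, S+b, S+c pairwise meet in dimension k-1, so they share a common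
-- (k-1)-dimensional subspace or the third lies in the sum of the other two. The latter is
-- impossible (`IsOrthoMap.not_le_sup`): some k-subspace through `c` is orthogonal to S+a and S+b,
-- so its image is orthogonal to their images, yet it is so close to S+c that the images of these
-- two must meet. The common intersection depends on `S` only (`IsOrthoMap.exists_kernel`) and
-- defines a map of (k-1)-subspaces of the same kind (`IsOrthoMap.exists_descent`). Repeating this
-- yields a map of lines that respects orthogonality and sends the lines of a plane into a plane,
-- encoded by unit representatives as `IsRayMap`.
--
-- Lines. What remains is a theorem of Wigner type without injectivity. The crux is
-- `IsRayMap.not_collapse`: two distinct non-orthogonal lines cannot have the same image. For a unit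
-- vector `e` the affine chart `rayLift` is then meaningful, and e+v ⟂ e+w reads 1+⟨v,w⟩=0. In two
-- orthogonal coordinates the preservation of this equation produces a ring endomorphism of ℂ
-- commuting with conjugation (`exists_ringHom_of_coordinates`), that is, the identity or
-- conjugation. It is the same in all directions, and the chart extends to the required isometry
-- (`IsRayMap.exists_isometry`).

theorem exists_unit_mem_orthogonal (V : Submodule ℂ H) [FiniteDimensional ℂ V]
    (h : (Module.finrank ℂ V : Cardinal) < Module.rank ℂ H) : ∃ x ∈ Vᗮ, ‖x‖ = 1 := by
  have hV : V ≠ ⊤ := by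
    rintro rfl
    rw [Module.finrank_eq_rank, rank_top] at h
    exact lt_irrefl _ h
  have hV' : Vᗮ ≠ ⊥ := fun h' => hV ((Submodule.orthogonal_eq_bot_iff).1 h')
  obtain ⟨x, hx, hx0⟩ := (Submodule.ne_bot_iff _).1 hV'
  refine ⟨((‖x‖⁻¹ : ℝ) : ℂ) • x, Submodule.smul_mem _ _ hx, ?_⟩
  rw [norm_smul, Complex.norm_real, norm_inv, norm_norm, inv_mul_cancel₀ (norm_ne_zero_iff.2 hx0)]

theorem finrank_sup_span_singleton {V : Submodule ℂ H} [FiniteDimensional ℂ V] {x : H}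
    (hx : x ≠ 0) (hxV : x ∈ Vᗮ) :
    Module.finrank ℂ (V ⊔ ℂ ∙ x : Submodule ℂ H) = Module.finrank ℂ V + 1 := by
  have hd : Disjoint V (ℂ ∙ x) :=
    (Submodule.isOrtho_iff_le.2 (by
      rw [Submodule.le_orthogonal_iff_le_orthogonal, Submodule.span_singleton_le_iff_mem]
      exact hxV)).disjoint
  have := Submodule.finrank_sup_add_finrank_inf_eq V (ℂ ∙ x)
  rw [hd.eq_bot, finrank_bot, finrank_span_singleton hx] at this
  simpa using this

theorem finrank_sup_span_singleton_le (V : Submodule ℂ H) [FiniteDimensional ℂ V] (x : H) :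
    Module.finrank ℂ (V ⊔ ℂ ∙ x : Submodule ℂ H) ≤ Module.finrank ℂ V + 1 :=
  (Submodule.finrank_add_le_finrank_add_finrank _ _).trans
    (Nat.add_le_add_left ((finrank_span_le_card ({x} : Set H)).trans (by simp)) _)

theorem isOrtho_span_singleton_right {V : Submodule ℂ H} {x : H} :
    V ⟂ (ℂ ∙ x) ↔ x ∈ Vᗮ := by
  rw [Submodule.isOrtho_comm, Submodule.isOrtho_iff_le, Submodule.span_singleton_le_iff_mem]

theorem isOrtho_span_singleton_span_singleton {x y : H} :
    (ℂ ∙ x) ⟂ (ℂ ∙ y) ↔ inner ℂ x y = 0 := by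
  rw [isOrtho_span_singleton_right, Submodule.mem_orthogonal_singleton_iff_inner_right]

theorem mem_orthogonal_sup_span_singleton {V : Submodule ℂ H} {x y : H} :
    y ∈ (V ⊔ ℂ ∙ x)ᗮ ↔ y ∈ Vᗮ ∧ inner ℂ x y = 0 := by
  rw [← Submodule.inf_orthogonal, Submodule.mem_inf, Submodule.mem_orthogonal_singleton_iff_inner_right]

theorem exists_unit_orthogonal_three (V : Submodule ℂ H) [FiniteDimensional ℂ V]
    (h : ((Module.finrank ℂ V + 3 : ℕ) : Cardinal) < Module.rank ℂ H) (a b c : H) :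
    ∃ x ∈ Vᗮ, ‖x‖ = 1 ∧ inner ℂ a x = 0 ∧ inner ℂ b x = 0 ∧ inner ℂ c x = 0 := by
  have h1 := finrank_sup_span_singleton_le V a
  have h2 := finrank_sup_span_singleton_le (V ⊔ ℂ ∙ a) b
  have h3 := finrank_sup_span_singleton_le (V ⊔ ℂ ∙ a ⊔ ℂ ∙ b) c
  obtain ⟨x, hx, hx1⟩ := exists_unit_mem_orthogonal (V ⊔ ℂ ∙ a ⊔ ℂ ∙ b ⊔ ℂ ∙ c)
    (lt_of_le_of_lt (by exact_mod_cast (by omega)) h)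
  simp only [mem_orthogonal_sup_span_singleton] at hx
  exact ⟨x, hx.1.1.1, hx1, hx.1.1.2, hx.1.2, hx.2⟩

theorem exists_finrank_eq_le_orthogonal (m : ℕ) (V : Submodule ℂ H) [FiniteDimensional ℂ V]
    (h : ((Module.finrank ℂ V + m : ℕ) : Cardinal) ≤ Module.rank ℂ H) :
    ∃ B : Submodule ℂ H, FiniteDimensional ℂ B ∧ V ⟂ B ∧ Module.finrank ℂ B = m := by
  induction m with
  | zero => exact ⟨⊥, inferInstance, Submodule.isOrtho_bot_right, finrank_bot _ _⟩
  | succ m ih =>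
    obtain ⟨B, hB, hVB, hm⟩ := ih (le_trans (by exact_mod_cast (by omega)) h)
    have h1 := Submodule.finrank_add_le_finrank_add_finrank V B
    obtain ⟨x, hx, hx1⟩ := exists_unit_mem_orthogonal (V ⊔ B)
      (lt_of_lt_of_le (by exact_mod_cast (by omega)) h)
    rw [← Submodule.inf_orthogonal, Submodule.mem_inf] at hx
    refine ⟨B ⊔ ℂ ∙ x, inferInstance, ?_, ?_⟩
    · exact Submodule.isOrtho_sup_right.2 ⟨hVB, isOrtho_span_singleton_right.2 hx.1⟩
    · rw [finrank_sup_span_singleton (norm_ne_zero_iff.1 (by simp [hx1])) hx.2, hm]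

/-- A finite-dimensional subspace splits orthogonally along any proper subspace. -/
theorem exists_le_orthogonal_splitting {V X : Submodule ℂ H} [FiniteDimensional ℂ X] (hVX : V ≤ X)
    (h : Module.finrank ℂ V + 1 ≤ Module.finrank ℂ X) :
    ∃ x ∈ X, x ≠ 0 ∧ x ∈ Vᗮ := by
  have : FiniteDimensional ℂ V := Submodule.finiteDimensional_of_le hVX
  by_contra! hc
  have : X ≤ V := by
    intro y hy
    have hp : y - V.orthogonalProjectionOnto y ∈ Vᗮ := V.sub_starProjection_mem_orthogonal y
    have hX : y - V.orthogonalProjectionOnto y ∈ X := X.sub_mem hy (hVX (Subtype.mem _))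
    by_cases h0 : y - V.orthogonalProjectionOnto y = 0
    · rw [sub_eq_zero.1 h0]; exact Subtype.mem _
    · exact absurd hp (hc _ hX h0)
  have := Submodule.finrank_mono this
  omega

theorem eq_sup_span_singleton_of_finrank {V X : Submodule ℂ H} [FiniteDimensional ℂ X] (hVX : V ≤ X)
    (h : Module.finrank ℂ X = Module.finrank ℂ V + 1) :
    ∃ x ∈ X, x ≠ 0 ∧ x ∈ Vᗮ ∧ X = V ⊔ ℂ ∙ x := by
  have : FiniteDimensional ℂ V := Submodule.finiteDimensional_of_le hVX
  obtain ⟨x, hx, hx0, hxV⟩ := exists_le_orthogonal_splitting hVX h.ge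
  refine ⟨x, hx, hx0, hxV, (Submodule.eq_of_le_of_finrank_eq ?_ ?_).symm⟩
  · exact sup_le hVX ((Submodule.span_singleton_le_iff_mem _ _).2 hx)
  · rw [finrank_sup_span_singleton hx0 hxV, h]

/-- Subspaces of all intermediate dimensions exist. -/
theorem exists_finrank_eq_between {X V : Submodule ℂ H} [FiniteDimensional ℂ X] (hVX : V ≤ X) {m : ℕ}
    (h1 : Module.finrank ℂ V ≤ m) (h2 : m ≤ Module.finrank ℂ X) :
    ∃ Y, V ≤ Y ∧ Y ≤ X ∧ Module.finrank ℂ Y = m := by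
  induction m, h1 using Nat.le_induction with
  | base => exact ⟨V, le_rfl, hVX, rfl⟩
  | succ m hm ih =>
    obtain ⟨Y, hVY, hYX, hY⟩ := ih (by omega)
    have : FiniteDimensional ℂ Y := Submodule.finiteDimensional_of_le hYX
    obtain ⟨x, hx, hx0, hxY⟩ := exists_le_orthogonal_splitting hYX (by omega)
    refine ⟨Y ⊔ ℂ ∙ x, hVY.trans le_sup_left,
      sup_le hYX ((Submodule.span_singleton_le_iff_mem _ _).2 hx), ?_⟩
    rw [finrank_sup_span_singleton hx0 hxY, hY]

theorem exists_eq_sup_span_singleton {m : ℕ} {X : Submodule ℂ H} [FiniteDimensional ℂ X]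
    (h : Module.finrank ℂ X = m + 1) :
    ∃ (V : Submodule ℂ H) (x : H), FiniteDimensional ℂ V ∧ Module.finrank ℂ V = m ∧ V ≤ X ∧
      x ∈ X ∧ x ≠ 0 ∧ x ∈ Vᗮ ∧ X = V ⊔ ℂ ∙ x := by
  obtain ⟨V, -, hVX, hV⟩ := exists_finrank_eq_between (V := ⊥) (m := m) (bot_le : ⊥ ≤ X)
    (by simp) (by omega)
  obtain ⟨x, hx, hx0, hxV, hX⟩ := eq_sup_span_singleton_of_finrank hVX (by omega)
  exact ⟨V, x, Submodule.finiteDimensional_of_le hVX, hV, hVX, hx, hx0, hxV, hX⟩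

theorem finrank_inf_add_finrank_inf_le (A B C : Submodule ℂ H) [FiniteDimensional ℂ A]
    [FiniteDimensional ℂ B] :
    Module.finrank ℂ (A ⊓ B : Submodule ℂ H) + Module.finrank ℂ (B ⊓ C : Submodule ℂ H) ≤
      Module.finrank ℂ B + Module.finrank ℂ (A ⊓ C : Submodule ℂ H) := by
  have : FiniteDimensional ℂ (A ⊓ B : Submodule ℂ H) :=
    Submodule.finiteDimensional_of_le inf_le_left
  have : FiniteDimensional ℂ (A ⊓ C : Submodule ℂ H) :=
    Submodule.finiteDimensional_of_le inf_le_left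
  have : FiniteDimensional ℂ (B ⊓ C : Submodule ℂ H) :=
    Submodule.finiteDimensional_of_le inf_le_left
  rw [← Submodule.finrank_sup_add_finrank_inf_eq]
  refine Nat.add_le_add (Submodule.finrank_mono (sup_le inf_le_right inf_le_left))
    (Submodule.finrank_mono ?_)
  exact le_inf (inf_le_left.trans inf_le_left) (inf_le_right.trans inf_le_right)

/-- Three pairwise adjacent subspaces lie in a common star or in a common top. -/
theorem le_sup_or_inf_le {k : ℕ} {A B C : Submodule ℂ H} [FiniteDimensional ℂ C]
    (hC : Module.finrank ℂ C = k)
    (hAB : Module.finrank ℂ (A ⊓ B : Submodule ℂ H) + 1 ≤ k)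
    (hAB' : FiniteDimensional ℂ A)
    (hAC : k ≤ Module.finrank ℂ (A ⊓ C : Submodule ℂ H) + 1)
    (hBC : k ≤ Module.finrank ℂ (B ⊓ C : Submodule ℂ H) + 1) : C ≤ A ⊔ B ∨ A ⊓ B ≤ C := by
  by_cases hle : C ≤ A ⊔ B
  · exact Or.inl hle
  right
  have hsub : A ⊓ C ⊔ B ⊓ C ≤ C := sup_le inf_le_right inf_le_right
  have hlt : A ⊓ C ⊔ B ⊓ C < C :=
    lt_of_le_of_ne hsub fun h => hle (h ▸ sup_le_sup inf_le_left inf_le_left)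
  have hlt' := Submodule.finrank_lt_finrank_of_lt hlt
  have : FiniteDimensional ℂ (A ⊓ C ⊔ B ⊓ C : Submodule ℂ H) :=
    Submodule.finiteDimensional_of_le hsub
  have h1 : A ⊓ C = A ⊓ C ⊔ B ⊓ C :=
    Submodule.eq_of_le_of_finrank_le le_sup_left (by omega)
  have h2 : B ⊓ C = A ⊓ C ⊔ B ⊓ C :=
    Submodule.eq_of_le_of_finrank_le le_sup_right (by omega)
  have : FiniteDimensional ℂ (A ⊓ B : Submodule ℂ H) :=
    Submodule.finiteDimensional_of_le inf_le_left
  have h3 : A ⊓ C ≤ A ⊓ B := le_inf inf_le_left ((h1.trans h2.symm).le.trans inf_le_left)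
  have h4 : A ⊓ C = A ⊓ B := Submodule.eq_of_le_of_finrank_le h3 (by omega)
  exact h4 ▸ inf_le_right

end Dimension

-- Descent from k-dimensional subspaces to lower dimensions.

section Descent

variable {H : Type*} [NormedAddCommGroup H] [InnerProductSpace ℂ H]

/-- A transformation of subspaces which acts on the `k`-dimensional ones, preserves their
orthogonality, and sends ortho-adjacent ones to adjacent or equal ones. -/
structure IsOrthoMap (k : ℕ) (F : Submodule ℂ H → Submodule ℂ H) : Prop where
  finrank_eq : ∀ X : Submodule ℂ H, Module.finrank ℂ X = k → Module.finrank ℂ (F X) = k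
  isOrtho : ∀ X Y : Submodule ℂ H, Module.finrank ℂ X = k → Module.finrank ℂ Y = k → X ⟂ Y → F X ⟂ F Y
  adj : ∀ (S : Submodule ℂ H) (a b : H), FiniteDimensional ℂ S → Module.finrank ℂ S + 1 = k →
    a ≠ 0 → b ≠ 0 → a ∈ Sᗮ → b ∈ Sᗮ → inner ℂ a b = 0 →
      k ≤ Module.finrank ℂ (F (S ⊔ ℂ ∙ a) ⊓ F (S ⊔ ℂ ∙ b) : Submodule ℂ H) + 1

variable {k : ℕ} {F : Submodule ℂ H → Submodule ℂ H}

theorem IsOrthoMap.finiteDimensional (hF : IsOrthoMap k F) (hk : 0 < k) {X : Submodule ℂ H}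
    (hX : Module.finrank ℂ X = k) : FiniteDimensional ℂ (F X) :=
  FiniteDimensional.of_finrank_pos (by rw [hF.finrank_eq X hX]; exact hk)

theorem finrank_sup_of_isOrtho {A B : Submodule ℂ H} [FiniteDimensional ℂ A]
    [FiniteDimensional ℂ B] (h : A ⟂ B) :
    Module.finrank ℂ (A ⊔ B : Submodule ℂ H) = Module.finrank ℂ A + Module.finrank ℂ B := by
  have := Submodule.finrank_sup_add_finrank_inf_eq A B
  rwa [h.disjoint.eq_bot, finrank_bot, add_zero] at this

/-- Exchange the vectors of an orthogonal basis of `S` for those of `B` one at a time: each exchange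
is an ortho-adjacency, so each of the `m` steps costs the images at most one common dimension. The
induction keeps the last exchanged vector `b` in the common part `A`. -/
theorem IsOrthoMap.finrank_le_finrank_inf (hF : IsOrthoMap k F) (hk : 0 < k) (m : ℕ) :
    ∀ (A S B : Submodule ℂ H), FiniteDimensional ℂ A → FiniteDimensional ℂ S →
      FiniteDimensional ℂ B → Module.finrank ℂ S = m → Module.finrank ℂ B = m →
      Module.finrank ℂ A + m = k → A ⟂ S → A ⟂ B → S ⟂ B →
      Module.finrank ℂ A ≤ Module.finrank ℂ (F (A ⊔ S) ⊓ F (A ⊔ B) : Submodule ℂ H) := by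
  induction m with
  | zero =>
    intro A S B _ _ _ hS hB hA _ _ _
    rw [Submodule.finrank_eq_zero.1 hS, Submodule.finrank_eq_zero.1 hB, inf_idem, sup_bot_eq,
      hF.finrank_eq A hA, ← hA, add_zero]
  | succ m ih =>
    intro A S B _ _ _ hS hB hA hAS hAB hSB
    obtain ⟨S', s, _, hS', hS'S, hsS, hs0, hs, rfl⟩ := exists_eq_sup_span_singleton hS
    obtain ⟨B', b, _, hB', hB'B, hbB, hb0, hb, rfl⟩ := exists_eq_sup_span_singleton hB
    have hAS' : A ⟂ S' := hAS.mono_right hS'S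
    have hAB' : A ⟂ B' := hAB.mono_right hB'B
    have hAs : s ∈ Aᗮ := isOrtho_span_singleton_right.1 (hAS.mono_right le_sup_right)
    have hAb : b ∈ Aᗮ := isOrtho_span_singleton_right.1 (hAB.mono_right le_sup_right)
    have hS'b : b ∈ S'ᗮ :=
      isOrtho_span_singleton_right.1 (hSB.mono le_sup_left le_sup_right)
    have hsb : inner ℂ s b = 0 := hSB.inner_eq hsS hbB
    have hAS'f := finrank_sup_of_isOrtho hAS'
    have hAbf := finrank_sup_span_singleton hb0 hAb
    have h1 := ih (A ⊔ ℂ ∙ b) S' B' inferInstance inferInstance inferInstance hS' hB' (by omega)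
      (Submodule.isOrtho_sup_left.2 ⟨hAS', (isOrtho_span_singleton_right.2 hS'b).symm⟩)
      (Submodule.isOrtho_sup_left.2 ⟨hAB', (isOrtho_span_singleton_right.2 hb).symm⟩)
      (hSB.mono hS'S hB'B)
    have h2 := hF.adj (A ⊔ S') s b inferInstance (by omega) hs0 hb0
      (by rw [← Submodule.inf_orthogonal]; exact ⟨hAs, hs⟩)
      (by rw [← Submodule.inf_orthogonal]; exact ⟨hAb, hS'b⟩) hsb
    have e1 : A ⊔ ℂ ∙ b ⊔ S' = A ⊔ S' ⊔ ℂ ∙ b := sup_right_comm _ _ _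
    have e2 : A ⊔ ℂ ∙ b ⊔ B' = A ⊔ (B' ⊔ ℂ ∙ b) := by rw [sup_right_comm, sup_assoc]
    rw [e1, e2] at h1
    rw [sup_assoc A S'] at h2
    have hX : Module.finrank ℂ (A ⊔ (S' ⊔ ℂ ∙ s) : Submodule ℂ H) = k := by
      rw [finrank_sup_of_isOrtho hAS, hS, hA]
    have hX' : Module.finrank ℂ (A ⊔ S' ⊔ ℂ ∙ b : Submodule ℂ H) = k := by
      rw [finrank_sup_span_singleton hb0 (by rw [← Submodule.inf_orthogonal]; exact ⟨hAb, hS'b⟩)]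
      omega
    have := hF.finiteDimensional hk hX
    have := hF.finiteDimensional hk hX'
    have h3 := finrank_inf_add_finrank_inf_le (F (A ⊔ (S' ⊔ ℂ ∙ s))) (F (A ⊔ S' ⊔ ℂ ∙ b))
      (F (A ⊔ (B' ⊔ ℂ ∙ b)))
    rw [hF.finrank_eq _ hX'] at h3
    omega

/-- For `B` orthogonal to everything in sight, c+B is orthogonal to S+a and S+b, so an inclusion
would make its image orthogonal to that of S+c. But c+B is k-1 exchanges away from S+c, so their
images share a line. Note that `a` and `b` need not be orthogonal, or even distinct. -/
theorem IsOrthoMap.not_le_sup (hF : IsOrthoMap k F)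
    (hdim : ((2 * k : ℕ) : Cardinal) < Module.rank ℂ H) {S : Submodule ℂ H}
    [FiniteDimensional ℂ S] (hS : Module.finrank ℂ S + 1 = k) {a b c : H} (ha0 : a ≠ 0)
    (hb0 : b ≠ 0) (hc0 : c ≠ 0) (ha : a ∈ Sᗮ) (hb : b ∈ Sᗮ) (hc : c ∈ Sᗮ)
    (hac : inner ℂ a c = 0) (hbc : inner ℂ b c = 0) :
    ¬ F (S ⊔ ℂ ∙ c) ≤ F (S ⊔ ℂ ∙ a) ⊔ F (S ⊔ ℂ ∙ b) := by
  intro hle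
  have h1 := finrank_sup_span_singleton_le S a
  have h2 := finrank_sup_span_singleton_le (S ⊔ ℂ ∙ a) b
  have h3 := finrank_sup_span_singleton_le (S ⊔ ℂ ∙ a ⊔ ℂ ∙ b) c
  -- The dimensions add up to at most (k-1)+3+(k-1) = 2k+1, exactly what the hypothesis on the rank
  -- allows.
  obtain ⟨B, _, hVB, hB⟩ := exists_finrank_eq_le_orthogonal (k - 1)
    (S ⊔ ℂ ∙ a ⊔ ℂ ∙ b ⊔ ℂ ∙ c)
    (le_trans (by exact_mod_cast (by omega)) (Order.succ_le_of_lt hdim) :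
      _ ≤ Module.rank ℂ H)
  simp only [Submodule.isOrtho_sup_left] at hVB
  obtain ⟨⟨⟨hSB, haB⟩, hbB⟩, hcB⟩ := hVB
  have hSc := isOrtho_span_singleton_right.2 hc
  have hpath := hF.finrank_le_finrank_inf (by omega) (k - 1) (ℂ ∙ c) S B inferInstance
    inferInstance inferInstance (by omega) hB (by rw [finrank_span_singleton hc0]; omega)
    hSc.symm hcB hSB
  have hZ : Module.finrank ℂ ((ℂ ∙ c) ⊔ B : Submodule ℂ H) = k := by
    rw [finrank_sup_of_isOrtho hcB, finrank_span_singleton hc0]; omega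
  have key : ∀ x : H, x ≠ 0 → x ∈ Sᗮ → inner ℂ x c = 0 → (ℂ ∙ x) ⟂ B →
      F (S ⊔ ℂ ∙ x) ⟂ F ((ℂ ∙ c) ⊔ B) := by
    intro x hx0 hx hxc hxB
    refine hF.isOrtho _ _ (by rw [finrank_sup_span_singleton hx0 hx]; exact hS) hZ ?_
    refine Submodule.isOrtho_sup_left.2 ⟨Submodule.isOrtho_sup_right.2 ⟨hSc, hSB⟩,
      Submodule.isOrtho_sup_right.2 ⟨?_, hxB⟩⟩
    exact isOrtho_span_singleton_span_singleton.2 hxc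
  have horth : F (S ⊔ ℂ ∙ c) ⟂ F ((ℂ ∙ c) ⊔ B) :=
    (Submodule.isOrtho_sup_left.2 ⟨key a ha0 ha hac haB, key b hb0 hb hbc hbB⟩).mono_left hle
  rw [sup_comm (ℂ ∙ c) S, horth.disjoint.eq_bot, finrank_bot, finrank_span_singleton hc0] at hpath
  omega

theorem IsOrthoMap.finrank_inf (hF : IsOrthoMap k F)
    (hdim : ((2 * k : ℕ) : Cardinal) < Module.rank ℂ H) {S : Submodule ℂ H}
    [FiniteDimensional ℂ S] (hS : Module.finrank ℂ S + 1 = k) {a b : H} (ha0 : a ≠ 0)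
    (hb0 : b ≠ 0) (ha : a ∈ Sᗮ) (hb : b ∈ Sᗮ) (hab : inner ℂ a b = 0) :
    Module.finrank ℂ (F (S ⊔ ℂ ∙ a) ⊓ F (S ⊔ ℂ ∙ b) : Submodule ℂ H) + 1 = k := by
  have hXa : Module.finrank ℂ (S ⊔ ℂ ∙ a : Submodule ℂ H) = k := by
    rw [finrank_sup_span_singleton ha0 ha, hS]
  have hXb : Module.finrank ℂ (S ⊔ ℂ ∙ b : Submodule ℂ H) = k := by
    rw [finrank_sup_span_singleton hb0 hb, hS]
  have := hF.finiteDimensional (by omega) hXb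
  refine le_antisymm ?_ (hF.adj S a b inferInstance hS ha0 hb0 ha hb hab)
  have hlt : F (S ⊔ ℂ ∙ a) ⊓ F (S ⊔ ℂ ∙ b) < F (S ⊔ ℂ ∙ b) := by
    refine lt_of_le_of_ne inf_le_right fun h => ?_
    -- Taking the first two vectors both equal to `a` rules out that one image contains the other.
    refine hF.not_le_sup hdim hS ha0 ha0 hb0 ha ha hb hab hab ?_
    rw [sup_idem]
    exact inf_eq_right.1 h
  have := Submodule.finrank_lt_finrank_of_lt hlt
  rw [hF.finrank_eq _ hXb] at this
  omega

theorem IsOrthoMap.inf_le (hF : IsOrthoMap k F)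
    (hdim : ((2 * k : ℕ) : Cardinal) < Module.rank ℂ H) {S : Submodule ℂ H}
    [FiniteDimensional ℂ S] (hS : Module.finrank ℂ S + 1 = k) {a b c : H} (ha0 : a ≠ 0)
    (hb0 : b ≠ 0) (hc0 : c ≠ 0) (ha : a ∈ Sᗮ) (hb : b ∈ Sᗮ) (hc : c ∈ Sᗮ)
    (hab : inner ℂ a b = 0) (hac : inner ℂ a c = 0) (hbc : inner ℂ b c = 0) :
    F (S ⊔ ℂ ∙ a) ⊓ F (S ⊔ ℂ ∙ b) ≤ F (S ⊔ ℂ ∙ c) := by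
  have hXa : Module.finrank ℂ (S ⊔ ℂ ∙ a : Submodule ℂ H) = k := by
    rw [finrank_sup_span_singleton ha0 ha, hS]
  have hXc : Module.finrank ℂ (S ⊔ ℂ ∙ c : Submodule ℂ H) = k := by
    rw [finrank_sup_span_singleton hc0 hc, hS]
  have := hF.finiteDimensional (by omega) hXc
  exact (le_sup_or_inf_le (hF.finrank_eq _ hXc)
    (hF.finrank_inf hdim hS ha0 hb0 ha hb hab).le (hF.finiteDimensional (by omega) hXa)
    (hF.adj S a c inferInstance hS ha0 hc0 ha hc hac)
    (hF.adj S b c inferInstance hS hb0 hc0 hb hc hbc)).resolve_left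
    (hF.not_le_sup hdim hS ha0 hb0 hc0 ha hb hc hac hbc)

theorem IsOrthoMap.inf_eq (hF : IsOrthoMap k F)
    (hdim : ((2 * k : ℕ) : Cardinal) < Module.rank ℂ H) {S : Submodule ℂ H}
    [FiniteDimensional ℂ S] (hS : Module.finrank ℂ S + 1 = k) {a b c : H} (ha0 : a ≠ 0)
    (hb0 : b ≠ 0) (hc0 : c ≠ 0) (ha : a ∈ Sᗮ) (hb : b ∈ Sᗮ) (hc : c ∈ Sᗮ)
    (hab : inner ℂ a b = 0) (hac : inner ℂ a c = 0) (hbc : inner ℂ b c = 0) :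
    F (S ⊔ ℂ ∙ a) ⊓ F (S ⊔ ℂ ∙ b) = F (S ⊔ ℂ ∙ b) ⊓ F (S ⊔ ℂ ∙ c) := by
  have hXb : Module.finrank ℂ (S ⊔ ℂ ∙ b : Submodule ℂ H) = k := by
    rw [finrank_sup_span_singleton hb0 hb, hS]
  have := hF.finiteDimensional (by omega) hXb
  have : FiniteDimensional ℂ (F (S ⊔ ℂ ∙ b) ⊓ F (S ⊔ ℂ ∙ c) : Submodule ℂ H) :=
    Submodule.finiteDimensional_of_le inf_le_left
  refine Submodule.eq_of_le_of_finrank_eq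
    (le_inf inf_le_right (hF.inf_le hdim hS ha0 hb0 hc0 ha hb hc hab hac hbc)) ?_
  have h1 := hF.finrank_inf hdim hS ha0 hb0 ha hb hab
  have h2 := hF.finrank_inf hdim hS hb0 hc0 hb hc hbc
  omega

/-- The intersection of the images along an orthogonal pair of directions in `Sᗮ` does not change
when the pair is replaced through an orthogonal triple, and any direction orthogonal to such a pair
has it in its image. -/
theorem IsOrthoMap.exists_kernel (hF : IsOrthoMap k F) (hk : 2 ≤ k)
    (hdim : ((2 * k : ℕ) : Cardinal) < Module.rank ℂ H) {S : Submodule ℂ H}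
    (hS : Module.finrank ℂ S + 1 = k) :
    ∃ K : Submodule ℂ H, Module.finrank ℂ K + 1 = k ∧
      ∀ X : Submodule ℂ H, Module.finrank ℂ X = k → S ≤ X → K ≤ F X := by
  have : FiniteDimensional ℂ S := FiniteDimensional.of_finrank_pos (by omega)
  have hex := exists_unit_orthogonal_three S (lt_of_le_of_lt (by exact_mod_cast (by omega)) hdim)
  have ne : ∀ {x : H}, ‖x‖ = 1 → x ≠ 0 := fun h h0 => by simp [h0] at h
  have sw : ∀ {x y : H}, inner ℂ x y = 0 → inner ℂ y x = 0 := fun h => inner_eq_zero_symm.1 h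
  obtain ⟨a, ha, ha1, -⟩ := hex 0 0 0
  obtain ⟨b, hb, hb1, hab, -⟩ := hex a 0 0
  refine ⟨F (S ⊔ ℂ ∙ a) ⊓ F (S ⊔ ℂ ∙ b), hF.finrank_inf hdim hS (ne ha1) (ne hb1) ha hb hab, ?_⟩
  intro X hX hSX
  have : FiniteDimensional ℂ X := FiniteDimensional.of_finrank_pos (by omega)
  obtain ⟨x, -, hx0, hx, rfl⟩ := eq_sup_span_singleton_of_finrank hSX (by omega)
  -- The given direction `x` need not be orthogonal to `a` or `b`, so the pair moves (a,b) → (b,y) →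
  -- (y,z) until both members are orthogonal to `x`.
  obtain ⟨y, hy, hy1, hay, hby, hxy⟩ := hex a b x
  obtain ⟨z, hz, hz1, hbz, hxz, hyz⟩ := hex b x y
  rw [hF.inf_eq hdim hS (ne ha1) (ne hb1) (ne hy1) ha hb hy hab hay hby,
    hF.inf_eq hdim hS (ne hb1) (ne hy1) (ne hz1) hb hy hz hby hbz hyz]
  exact hF.inf_le hdim hS (ne hy1) (ne hz1) hx0 hy hz hx hyz (sw hxy) (sw hxz)

/-- A map of `(k+1)`-dimensional subspaces induces a map of `k`-dimensional subspaces. -/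
theorem IsOrthoMap.exists_descent (hF : IsOrthoMap (k + 1) F) (hk : 1 ≤ k)
    (hdim : ((2 * (k + 1) : ℕ) : Cardinal) < Module.rank ℂ H) :
    ∃ G : Submodule ℂ H → Submodule ℂ H, IsOrthoMap k G ∧
      ∀ S X : Submodule ℂ H, Module.finrank ℂ S = k → Module.finrank ℂ X = k + 1 → S ≤ X → G S ≤ F X := by
  have hex : ∀ S : Submodule ℂ H, ∃ K : Submodule ℂ H, Module.finrank ℂ S = k →
      Module.finrank ℂ K = k ∧ ∀ X : Submodule ℂ H, Module.finrank ℂ X = k + 1 → S ≤ X → K ≤ F X := by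
    intro S
    by_cases hS : Module.finrank ℂ S = k
    · obtain ⟨K, hK, h⟩ := hF.exists_kernel (by omega) hdim (S := S) (by omega)
      exact ⟨K, fun _ => ⟨by omega, h⟩⟩
    · exact ⟨⊥, fun h => absurd h hS⟩
  choose G hG using hex
  refine ⟨G, ⟨fun X hX => (hG X hX).1, ?_, ?_⟩, fun S X hS hX h => (hG S hS).2 X hX h⟩
  · intro S T hS hT hST
    have : FiniteDimensional ℂ S := FiniteDimensional.of_finrank_pos (by omega)
    have : FiniteDimensional ℂ T := FiniteDimensional.of_finrank_pos (by omega)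
    have h0 := finrank_sup_of_isOrtho hST
    -- Enlarging S and T by orthogonal directions gives orthogonal subspaces of dimension k+1 whose
    -- images contain `G S` and `G T`.
    obtain ⟨a, ha, ha1⟩ := exists_unit_mem_orthogonal (S ⊔ T)
      (lt_of_le_of_lt (by exact_mod_cast (by omega)) hdim)
    have h1 := finrank_sup_span_singleton_le (S ⊔ T) a
    obtain ⟨b, hb, hb1⟩ := exists_unit_mem_orthogonal (S ⊔ T ⊔ ℂ ∙ a)
      (lt_of_le_of_lt (by exact_mod_cast (by omega)) hdim)
    rw [mem_orthogonal_sup_span_singleton] at hb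
    obtain ⟨hb, hab⟩ := hb
    rw [← Submodule.inf_orthogonal] at ha hb
    have ha0 : a ≠ 0 := norm_ne_zero_iff.1 (by simp [ha1])
    have hb0 : b ≠ 0 := norm_ne_zero_iff.1 (by simp [hb1])
    have hXa := (finrank_sup_span_singleton ha0 ha.1).trans (by rw [hS])
    have hXb := (finrank_sup_span_singleton hb0 hb.2).trans (by rw [hT])
    refine (hF.isOrtho _ _ hXa hXb ?_).mono ((hG S hS).2 _ hXa le_sup_left)
      ((hG T hT).2 _ hXb le_sup_left)
    refine Submodule.isOrtho_sup_left.2 ⟨Submodule.isOrtho_sup_right.2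
      ⟨hST, isOrtho_span_singleton_right.2 hb.1⟩, Submodule.isOrtho_sup_right.2
      ⟨(isOrtho_span_singleton_right.2 ha.2).symm, isOrtho_span_singleton_span_singleton.2 hab⟩⟩
  · intro S a b _ hS ha0 hb0 ha hb hab
    have hSa := (finrank_sup_span_singleton ha0 ha).trans hS
    have hSb := (finrank_sup_span_singleton hb0 hb).trans hS
    -- Both values of `G` have dimension k and lie in the (k+1)-dimensional image of S+a+b, hence
    -- they meet in dimension at least k-1.
    have hX : Module.finrank ℂ (S ⊔ ℂ ∙ a ⊔ ℂ ∙ b : Submodule ℂ H) = k + 1 := by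
      rw [finrank_sup_span_singleton hb0 (mem_orthogonal_sup_span_singleton.2 ⟨hb, hab⟩), hSa]
    have := hF.finiteDimensional (by omega) hX
    have h1 := (hG _ hSa).2 _ hX le_sup_left
    have h2 := (hG _ hSb).2 _ hX (sup_le_sup_right le_sup_left _)
    have := Submodule.finiteDimensional_of_le h1
    have := Submodule.finiteDimensional_of_le h2
    have h3 := Submodule.finrank_sup_add_finrank_inf_eq (G (S ⊔ ℂ ∙ a)) (G (S ⊔ ℂ ∙ b))
    have h4 := Submodule.finrank_mono (sup_le h1 h2)
    rw [(hG _ hSa).1, (hG _ hSb).1] at h3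
    rw [hF.finrank_eq _ hX] at h4
    omega

theorem IsOrthoMap.exists_descent_to (hk : 2 ≤ k) :
    ∀ F : Submodule ℂ H → Submodule ℂ H, IsOrthoMap k F →
    ((2 * k : ℕ) : Cardinal) < Module.rank ℂ H →
    ∃ G : Submodule ℂ H → Submodule ℂ H, IsOrthoMap 2 G ∧
      ∀ S X : Submodule ℂ H, Module.finrank ℂ S = 2 → Module.finrank ℂ X = k → S ≤ X → G S ≤ F X := by
  induction k, hk using Nat.le_induction with
  | base =>
    intro F hF _
    refine ⟨F, hF, fun S X hS hX h => ?_⟩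
    have : FiniteDimensional ℂ X := FiniteDimensional.of_finrank_pos (by omega)
    rw [Submodule.eq_of_le_of_finrank_eq h (by omega)]
  | succ k hk ih =>
    intro F hF hdim
    obtain ⟨F', hF', hle⟩ := hF.exists_descent (by omega) hdim
    obtain ⟨G, hG, hle'⟩ := ih F' hF' (lt_of_le_of_lt (by exact_mod_cast (by omega)) hdim)
    refine ⟨G, hG, fun S X hS hX h => ?_⟩
    have : FiniteDimensional ℂ X := FiniteDimensional.of_finrank_pos (by omega)
    obtain ⟨Y, hSY, hYX, hY⟩ := exists_finrank_eq_between h (m := k) (by omega) (by omega)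
    exact (hle' S Y hS hY hSY).trans (hle Y X hY hX hYX)

end Descent

-- Arithmetic of ℂ behind the rigidity of maps of projective planes.

section ComplexNumbers

open ComplexConjugate

/-- The argument of 1+k/(1+si) is continuous in s, vanishes at s=0 and is negative at s=1, so it
takes the value -π/n for large n; the n-th power is then a negative real. -/
theorem exists_pow_eq_neg_of_circle {k : ℝ} (hk : 0 < k) :
    ∃ (s : ℝ) (n : ℕ) (r : ℝ), s ≠ 0 ∧ n ≠ 0 ∧ r < 0 ∧
      (1 + (k : ℂ) / (1 + s * Complex.I)) ^ n = r := by
  set z : ℝ → ℂ := fun s => 1 + (k : ℂ) / (1 + s * Complex.I) with hz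
  have hne : ∀ s : ℝ, (1 + s * Complex.I : ℂ) ≠ 0 := by
    intro s h
    simpa using congrArg Complex.re h
  have hz_eq : ∀ s : ℝ, z s = ((1 + k / (1 + s ^ 2) : ℝ) : ℂ) + ((-(k * s) / (1 + s ^ 2) : ℝ) : ℂ) * Complex.I := by
    intro s
    have h2 : (1 + (s : ℂ) ^ 2) ≠ 0 := by
      norm_cast
      positivity
    have := hne s
    simp only [hz]
    push_cast
    field_simp
    linear_combination ((k : ℂ) * s ^ 2) * Complex.I_sq
  have hre : ∀ s, 0 < (z s).re := by
    intro s
    rw [hz_eq]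
    simp only [Complex.add_re, Complex.ofReal_re, Complex.mul_re, Complex.I_re, Complex.ofReal_im,
      Complex.I_im]
    have : 0 < k / (1 + s ^ 2) := by positivity
    linarith
  have hcont : Continuous z := by
    simp only [hz]
    exact continuous_const.add (continuous_const.div (by fun_prop) hne)
  have harg : Continuous fun s => (z s).arg :=
    continuous_iff_continuousAt.2 fun s =>
      (Complex.continuousAt_arg (Or.inl (hre s))).comp hcont.continuousAt
  have h0 : (z 0).arg = 0 := by
    have : z 0 = ((1 + k : ℝ) : ℂ) := by simp [hz]
    rw [this, Complex.arg_ofReal_of_nonneg (by linarith)]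
  have h1 : (z 1).arg < 0 := by
    rw [Complex.arg_neg_iff, hz_eq]
    simp only [Complex.add_im, Complex.ofReal_im, Complex.mul_im, Complex.I_re, Complex.ofReal_re,
      Complex.I_im]
    norm_num
    linarith
  obtain ⟨n, hn⟩ := exists_nat_gt (Real.pi / (-(z 1).arg))
  have hn0 : (0 : ℝ) < n := lt_of_le_of_lt (div_nonneg Real.pi_pos.le (by linarith)) hn
  rw [div_lt_iff₀ (by linarith)] at hn
  have hmem : -(Real.pi / n) ∈ Set.Icc (z 1).arg (z 0).arg := by
    refine ⟨?_, by rw [h0, neg_nonpos]; exact div_nonneg Real.pi_pos.le hn0.le⟩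
    have : Real.pi / n < -(z 1).arg := by
      rw [div_lt_iff₀ hn0]; linarith
    linarith
  obtain ⟨s, hs⟩ := mem_range_of_exists_le_of_exists_ge harg ⟨1, hmem.1⟩ ⟨0, hmem.2⟩
  refine ⟨s, n, -‖z s‖ ^ n, ?_, by exact_mod_cast hn0.ne', ?_, ?_⟩
  · rintro rfl
    simp only [h0] at hs
    have : 0 < Real.pi / n := div_pos Real.pi_pos hn0
    linarith
  · rw [neg_lt_zero]
    refine pow_pos (norm_pos_iff.2 fun h => ?_) _
    have := hre s
    rw [h] at this
    simp at this
  · have hn' : (n : ℂ) ≠ 0 := by exact_mod_cast hn0.ne'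
    change z s ^ n = _
    conv_lhs => rw [← Complex.norm_mul_exp_arg_mul_I (z s)]
    simp only at hs
    rw [hs, mul_pow, ← Complex.exp_nat_mul]
    have : (n : ℂ) * (((-(Real.pi / n) : ℝ) : ℂ) * Complex.I) = -(Real.pi * Complex.I) := by
      push_cast
      field_simp
    rw [this, Complex.exp_neg, Complex.exp_pi_mul_I]
    push_cast
    norm_num

/-- At u=is the first alternative squares to the negative real -s², while the second gives
1+k/(1+is), which for a suitable s has a negative real power. -/
theorem false_of_mul_closed (P : ℂ → Prop) (hmul : ∀ a b, P a → P b → P (a * b))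
    (hneg : ∀ r : ℝ, r < 0 → ¬ P r) {k : ℝ} (hk : 0 < k)
    (h : ∀ u : ℂ, u ≠ 1 → P u ∨ P (1 - k / (conj u - 1))) : False := by
  obtain ⟨s, n, r, hs, hn, hr, hpow⟩ := exists_pow_eq_neg_of_circle hk
  have hP : P (1 + (k : ℂ) / (1 + s * Complex.I)) := by
    rcases h (s * Complex.I) (fun h => by simpa using congrArg Complex.re h) with h1 | h1
    · exfalso
      refine hneg (-s ^ 2) (by have := sq_pos_of_ne_zero hs; linarith) ?_
      have := hmul _ _ h1 h1
      have e : (s * Complex.I) * (s * Complex.I) = ((-s ^ 2 : ℝ) : ℂ) := by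
        push_cast
        linear_combination (s : ℂ) ^ 2 * Complex.I_sq
      rwa [e] at this
    · have e : conj (s * Complex.I : ℂ) - 1 = -(1 + s * Complex.I) := by
        simp
        ring
      rwa [e, div_neg, sub_neg_eq_add] at h1
  have hPn : ∀ m : ℕ, P ((1 + (k : ℂ) / (1 + s * Complex.I)) ^ (m + 1)) := by
    intro m
    induction m with
    | zero => simpa using hP
    | succ m ih => rw [pow_succ]; exact hmul _ _ ih hP
  refine hneg r hr ?_
  rw [← hpow, ← Nat.succ_pred_eq_of_ne_zero hn]
  exact hPn _

/-- Commuting with conjugation makes σ preserve ℝ, whose only ring endomorphism is the identity; so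
σ is an ℝ-algebra map of ℂ. -/
theorem ringHom_eq_id_or_conj {σ : ℂ →+* ℂ} (h : ∀ z, σ (conj z) = conj (σ z)) :
    σ = RingHom.id ℂ ∨ σ = starRingEnd ℂ := by
  have him : ∀ r : ℝ, ((σ r).re : ℂ) = σ r := by
    intro r
    have := h r
    rw [Complex.conj_ofReal] at this
    exact Complex.conj_eq_iff_re.1 this.symm
  let τ : ℝ →+* ℝ :=
    { toFun := fun r => (σ r).re
      map_one' := by simp
      map_zero' := by simp
      map_add' := by intro a b; simp
      map_mul' := by
        intro a b
        rw [Complex.ofReal_mul, map_mul, ← him a, ← him b, ← Complex.ofReal_mul]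
        simp only [Complex.ofReal_re] }
  have hτ : ∀ r : ℝ, σ r = r := by
    intro r
    rw [← him r]
    have : τ r = r := by rw [Subsingleton.elim τ (RingHom.id ℝ)]; rfl
    exact congrArg _ this
  let φ : ℂ →ₐ[ℝ] ℂ := { σ with commutes' := hτ }
  rcases Complex.real_algHom_eq_id_or_conj φ with h | h
  · exact Or.inl (RingHom.ext fun z => congrArg (fun ψ : ℂ →ₐ[ℝ] ℂ => ψ z) h)
  · exact Or.inr (RingHom.ext fun z => congrArg (fun ψ : ℂ →ₐ[ℝ] ℂ => ψ z) h)

/-- Coordinate functions of an orthogonality preserving map of a complex projective plane. -/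
theorem exists_ringHom_of_coordinates {j h : ℂ → ℂ} (j0 : j 0 = 0) (h0 : h 0 = 0)
    (H : ∀ a b c d, 1 + conj a * b + conj c * d = 0 →
      1 + conj (j a) * j b + conj (h c) * h d = 0) :
    ∃ σ : ℂ →+* ℂ, (σ = RingHom.id ℂ ∨ σ = starRingEnd ℂ) ∧ (∀ x, j x = σ x * j 1) ∧
      (∀ x, h x = σ x * h 1) ∧ ‖j 1‖ = 1 ∧ ‖h 1‖ = 1 := by
  -- Varying a, b with conj a * b fixed shows that conj (j a) * j b depends on this product only, so
  -- the normalised function conj (j 1) * j is multiplicative. The hypotheses are symmetric in `j`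
  -- and `h`, so this serves both.
  have half : ∀ {j h : ℂ → ℂ}, j 0 = 0 → h 0 = 0 →
      (∀ a b c d, 1 + conj a * b + conj c * d = 0 →
        1 + conj (j a) * j b + conj (h c) * h d = 0) →
      (∀ a b, conj (j a) * j b = conj (j 1) * j (conj a * b)) ∧ conj (j 1) * j 1 = 1 ∧
      (∀ s t, conj (j 1) * j (s * t) = (conj (j 1) * j s) * (conj (j 1) * j t)) ∧
      conj (j 1) * j (-1) = -1 := by
    intro j h j0 h0 H
    have hF : ∀ a b, conj (j a) * j b = conj (j 1) * j (conj a * b) := by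
      intro a b
      have h1 := H a b 1 (-1 - conj a * b) (by simp)
      have h2 := H 1 (conj a * b) 1 (-1 - conj a * b) (by simp)
      linear_combination h1 - h2
    have hm1 : conj (j 1) * j (-1) = -1 := by
      have := H 1 (-1) 0 0 (by simp)
      rw [h0] at this
      linear_combination this
    have hmul : ∀ s t, (conj (j 1) * j 1) * (conj (j 1) * j (s * t)) =
        (conj (j 1) * j s) * (conj (j 1) * j t) := by
      intro s t
      have h1 := hF (conj s) 1
      have h2 := hF (conj s) t
      simp only [Complex.conj_conj, mul_one] at h1 h2
      rw [← h2, ← h1]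
      ring
    -- The multiplicativity relation at (-1,-1) says that |j 1|² has square 1, and it is
    -- non-negative.
    have hm : conj (j 1) * j 1 = 1 := by
      have := hmul (-1) (-1)
      rw [hm1, neg_mul_neg, one_mul] at this
      rw [← Complex.normSq_eq_conj_mul_self] at this ⊢
      norm_cast at this ⊢
      nlinarith [Complex.normSq_nonneg (j 1)]
    refine ⟨hF, hm, fun s t => ?_, hm1⟩
    rw [← hmul, hm, one_mul]
  obtain ⟨jF, jm, jmul, jm1⟩ := half j0 h0 H
  obtain ⟨hF, hm, hmul, hm1⟩ := half h0 j0 fun a b c d hh => by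
    have := H c d a b (by linear_combination hh)
    linear_combination this
  have hG : ∀ s, conj (h 1) * h (s + 1) = 1 + conj (j 1) * j s := by
    intro s
    have h1 := H 1 s 1 (-1 * (s + 1)) (by rw [map_one]; ring)
    rw [hmul, hm1] at h1
    linear_combination -h1
  have hJ : ∀ s, conj (j 1) * j (s + 1) = 1 + conj (h 1) * h s := by
    intro s
    have h1 := H 1 (-1 * (s + 1)) 1 s (by rw [map_one]; ring)
    rw [jmul, jm1] at h1
    linear_combination -h1
  have j2 : ∀ s, conj (j 1) * j (s + 1 + 1) = 2 + conj (j 1) * j s := by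
    intro s
    rw [hJ, hG]
    ring
  have jtwo : conj (j 1) * j 2 = 2 := by
    have := j2 0
    rw [j0] at this
    norm_num at this
    exact this
  -- Compute the value at 2(s+1) = 2s+1+1 in two ways. With multiplicativity, additivity of 1 alone
  -- gives full additivity through s+t = t(s/t+1).
  have jsucc : ∀ s, conj (j 1) * j (s + 1) = conj (j 1) * j s + 1 := by
    intro s
    have h1 := jmul 2 (s + 1)
    have h2 := j2 (2 * s)
    rw [jmul 2 s, jtwo] at h2
    rw [jtwo, show (2 : ℂ) * (s + 1) = 2 * s + 1 + 1 by ring, h2] at h1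
    linear_combination -h1 / 2
  have hjh : ∀ s, conj (h 1) * h s = conj (j 1) * j s := by
    intro s
    have := hJ s
    rw [jsucc] at this
    linear_combination -this
  let σ : ℂ →+* ℂ :=
    { toFun := fun s => conj (j 1) * j s
      map_one' := jm
      map_zero' := by rw [j0, mul_zero]
      map_mul' := jmul
      map_add' := by
        intro s t
        by_cases ht : t = 0
        · rw [ht, j0, add_zero, mul_zero, add_zero]
        · have h1 := jmul t (s / t + 1)
          have h2 := jmul t (s / t)
          rw [show t * (s / t + 1) = s + t by field_simp, jsucc] at h1
          rw [show t * (s / t) = s by field_simp] at h2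
          rw [h1, h2]
          ring }
  have norm_one : ∀ z : ℂ, conj z * z = 1 → ‖z‖ = 1 := by
    intro z hz
    rw [← Complex.normSq_eq_conj_mul_self] at hz
    norm_cast at hz
    rw [Complex.normSq_eq_norm_sq] at hz
    nlinarith [norm_nonneg z]
  refine ⟨σ, ringHom_eq_id_or_conj fun z => ?_, fun x => ?_, fun x => ?_, norm_one _ jm,
    norm_one _ hm⟩
  · change conj (j 1) * j (conj z) = conj (conj (j 1) * j z)
    have := jF z 1
    rw [mul_one] at this
    rw [← this, map_mul, Complex.conj_conj, mul_comm]
  · change j x = conj (j 1) * j x * j 1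
    linear_combination -j x * jm
  · change h x = conj (j 1) * j x * h 1
    rw [← hjh]
    linear_combination -h x * hm

end ComplexNumbers

-- Maps of lines and the exclusion of collapsing.

section RayMaps

open ComplexConjugate

variable {H : Type*} [NormedAddCommGroup H] [InnerProductSpace ℂ H]

/-- A choice of unit representatives of an orthogonality preserving map of lines which sends every
line of a plane to a line of the corresponding plane. -/
structure IsRayMap (γ : H → H) : Prop where
  zero : γ 0 = 0
  norm : ∀ v, v ≠ 0 → ‖γ v‖ = 1
  orth : ∀ v w, inner ℂ v w = 0 → inner ℂ (γ v) (γ w) = 0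
  smul : ∀ (c : ℂ) v, ∃ d : ℂ, γ (c • v) = d • γ v
  add : ∀ v w, inner ℂ v w = 0 → ∃ a b : ℂ, γ (v + w) = a • γ v + b • γ w

variable {γ : H → H}

theorem IsRayMap.ne_zero (hγ : IsRayMap γ) {v : H} (hv : v ≠ 0) : γ v ≠ 0 :=
  norm_ne_zero_iff.1 (by simp [hγ.norm v hv])

theorem IsRayMap.inner_self (hγ : IsRayMap γ) {v : H} (hv : v ≠ 0) :
    inner ℂ (γ v) (γ v) = 1 := by
  rw [inner_self_eq_norm_sq_to_K, hγ.norm v hv]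
  simp

theorem IsRayMap.comb (hγ : IsRayMap γ) {v w : H} (h : inner ℂ v w = 0) (s t : ℂ) :
    ∃ a b : ℂ, γ (s • v + t • w) = a • γ v + b • γ w := by
  obtain ⟨a, b, hab⟩ := hγ.add (s • v) (t • w) (by rw [inner_smul_left, inner_smul_right, h]; simp)
  obtain ⟨c, hc⟩ := hγ.smul s v
  obtain ⟨d, hd⟩ := hγ.smul t w
  exact ⟨a * c, b * d, by rw [hab, hc, hd, smul_smul, smul_smul]⟩

theorem IsRayMap.span_eq (hγ : IsRayMap γ) {v w : H} {d : ℂ} (hv : v ≠ 0)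
    (h : γ v = d • γ w) : (ℂ ∙ γ v) = ℂ ∙ γ w := by
  have hd : d ≠ 0 := by
    rintro rfl
    exact hγ.ne_zero hv (by rw [h, zero_smul])
  rw [h, Submodule.span_singleton_smul_eq hd.isUnit]

theorem exists_smul_of_span_eq {v w : H} (h : (ℂ ∙ v) = ℂ ∙ w) : ∃ d : ℂ, v = d • w := by
  obtain ⟨d, hd⟩ := Submodule.mem_span_singleton.1 (h ▸ Submodule.mem_span_singleton_self v)
  exact ⟨d, hd.symm⟩

theorem IsRayMap.span_smul (hγ : IsRayMap γ) {v : H} {c : ℂ} (hc : c ≠ 0) :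
    (ℂ ∙ γ (c • v)) = ℂ ∙ γ v := by
  by_cases hv : v = 0
  · rw [hv, smul_zero]
  · obtain ⟨d, hd⟩ := hγ.smul c v
    exact hγ.span_eq (smul_ne_zero hc hv) hd

section Collapse

variable {e₁ e₂ e₃ : H}

theorem add_smul_ne_zero (n1 : ‖e₁‖ = 1) {w : H} (hw : inner ℂ e₁ w = 0) : e₁ + w ≠ 0 := by
  intro h
  have := congrArg (inner ℂ e₁) h
  rw [inner_add_right, hw, inner_zero_right, inner_self_eq_norm_sq_to_K, n1] at this
  simp at this

/-- If b = e₁+c•e₂ has the image of e₁, then the vector e₂-conj c•e₁ orthogonal to b has the image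
of e₂. So e₁+x•e₂+y•e₃ can be split along both orthogonal frames with the same image frame, and
removing the γ e₂ component identifies the images of the two remaining parts. -/
theorem IsRayMap.collapse_step (hγ : IsRayMap γ) (n1 : ‖e₁‖ = 1) (n2 : ‖e₂‖ = 1) (n3 : ‖e₃‖ = 1)
    (h12 : inner ℂ e₁ e₂ = 0) (h13 : inner ℂ e₁ e₃ = 0) (h23 : inner ℂ e₂ e₃ = 0) {c : ℂ}
    (hb : (ℂ ∙ γ (e₁ + c • e₂)) = ℂ ∙ γ e₁) {x : ℂ}
    (hx : (ℂ ∙ γ (e₁ + x • e₂)) ≠ ℂ ∙ γ e₂) :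
    1 + conj c * x ≠ 0 ∧ ∀ y : ℂ, (ℂ ∙ γ (e₁ + y • e₃)) =
      ℂ ∙ γ (e₁ + c • e₂ + (y * (1 + conj c * c) / (1 + conj c * x)) • e₃) := by
  have h21 : inner ℂ e₂ e₁ = 0 := inner_eq_zero_symm.1 h12
  have h31 : inner ℂ e₃ e₁ = 0 := inner_eq_zero_symm.1 h13
  have h32 : inner ℂ e₃ e₂ = 0 := inner_eq_zero_symm.1 h23
  have i1 : inner ℂ e₁ e₁ = (1 : ℂ) := by rw [inner_self_eq_norm_sq_to_K, n1]; simp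
  have i2 : inner ℂ e₂ e₂ = (1 : ℂ) := by rw [inner_self_eq_norm_sq_to_K, n2]; simp
  have ne1 : e₁ ≠ 0 := norm_ne_zero_iff.1 (by simp [n1])
  have ne2 : e₂ ≠ 0 := norm_ne_zero_iff.1 (by simp [n2])
  have ne3 : e₃ ≠ 0 := norm_ne_zero_iff.1 (by simp [n3])
  have f11 := hγ.inner_self ne1
  have f22 := hγ.inner_self ne2
  have f33 := hγ.inner_self ne3
  have f12 := hγ.orth _ _ h12
  have f13 := hγ.orth _ _ h13
  have f23 := hγ.orth _ _ h23
  have f21 := hγ.orth _ _ h21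
  have f31 := hγ.orth _ _ h31
  have f32 := hγ.orth _ _ h32
  obtain ⟨β, hβ⟩ := exists_smul_of_span_eq hb
  have hb0 : e₁ + c • e₂ ≠ 0 := add_smul_ne_zero n1 (by rw [inner_smul_right, h12, mul_zero])
  have hβ0 : β ≠ 0 := by
    rintro rfl
    exact hγ.ne_zero hb0 (by rw [hβ, zero_smul])
  have hx0 : e₁ + x • e₂ ≠ 0 := add_smul_ne_zero n1 (by rw [inner_smul_right, h12, mul_zero])
  obtain ⟨r, s, hrs⟩ := hγ.comb h12 1 x
  rw [one_smul] at hrs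
  have hα : 1 + conj c * x ≠ 0 := by
    intro h
    have h1 : inner ℂ (e₁ + c • e₂) (e₁ + x • e₂) = 0 := by
      simp only [inner_add_left, inner_add_right, inner_smul_left, inner_smul_right, h12, h21, i1,
        i2]
      linear_combination h
    have h2 := hγ.orth _ _ h1
    rw [hβ, hrs] at h2
    simp only [inner_add_right, inner_smul_left, inner_smul_right, f12, f11, mul_one,
      mul_zero, add_zero] at h2
    have hr : r = 0 := (mul_eq_zero.1 h2).resolve_right (by simpa using hβ0)
    rw [hr, zero_smul, zero_add] at hrs
    exact hx (hγ.span_eq hx0 hrs)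
  refine ⟨hα, fun y => ?_⟩
  have hQ : (1 + conj c * c) ≠ 0 := by
    rw [← Complex.normSq_eq_conj_mul_self]
    norm_cast
    have := Complex.normSq_nonneg c
    positivity
  -- The coefficient ⟨b,v⟩/⟨b,b⟩ of v = e₁+x•e₂+y•e₃ along b = e₁+c•e₂.
  set α := (1 + conj c * x) / (1 + conj c * c) with hαdef
  have hα0 : α ≠ 0 := div_ne_zero hα hQ
  have hbb : inner ℂ (e₁ + c • e₂) (e₂ - conj c • e₁) = 0 := by
    simp only [inner_add_left, inner_sub_right, inner_smul_left, inner_smul_right, h12, h21, i1,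
      i2]
    ring
  obtain ⟨p, δ, hδ⟩ := hγ.comb h12 (-conj c) 1
  rw [one_smul, neg_smul, neg_add_eq_sub] at hδ
  have hp : p = 0 := by
    have h2 := hγ.orth _ _ hbb
    rw [hβ, hδ] at h2
    simp only [inner_add_right, inner_smul_left, inner_smul_right, f12, f11, mul_one,
      mul_zero, add_zero] at h2
    exact (mul_eq_zero.1 h2).resolve_right (by simpa using hβ0)
  rw [hp, zero_smul, zero_add] at hδ
  have i_b3 : inner ℂ (e₁ + c • e₂) e₃ = 0 := by
    rw [inner_add_left, inner_smul_left, h13, h23]; simp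
  have i_b'3 : inner ℂ (e₂ - conj c • e₁) e₃ = 0 := by
    rw [inner_sub_left, inner_smul_left, h13, h23]; simp
  set v := e₁ + x • e₂ + y • e₃ with hv
  have hv0 : v ≠ 0 := by
    rw [hv, add_assoc]
    exact add_smul_ne_zero n1 (by rw [inner_add_right, inner_smul_right, inner_smul_right, h12, h13]; simp)
  obtain ⟨a1, a2, ha⟩ := hγ.comb (v := e₁ + y • e₃) (w := e₂)
    (by rw [inner_add_left, inner_smul_left, h12, h32]; simp) 1 x
  obtain ⟨a3, a4, ha'⟩ := hγ.comb (v := α • (e₁ + c • e₂) + y • e₃) (w := e₂ - conj c • e₁)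
    (by
      rw [inner_add_left, inner_smul_left, hbb, inner_smul_left, inner_eq_zero_symm.1 i_b'3]
      simp) 1 (x - α * c)
  obtain ⟨a5, a6, ha''⟩ := hγ.comb (v := e₁ + x • e₂) (w := e₃)
    (by rw [inner_add_left, inner_smul_left, h13, h23]; simp) 1 y
  rw [one_smul, show e₁ + y • e₃ + x • e₂ = v by rw [hv]; abel] at ha
  rw [one_smul, show α • (e₁ + c • e₂) + y • e₃ + (x - α * c) • (e₂ - conj c • e₁) = v by
    have hcoef : α - (x - α * c) * conj c = 1 := by
      rw [hαdef]
      field_simp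
      ring
    calc _ = (α - (x - α * c) * conj c) • e₁ + x • e₂ + y • e₃ := by module
      _ = v := by rw [hcoef, one_smul]] at ha'
  rw [one_smul, ← hv] at ha''
  obtain ⟨q1, q3, hq⟩ := hγ.comb h13 1 y
  obtain ⟨q1', q3', hq'⟩ := hγ.comb i_b3 α y
  rw [one_smul] at hq
  have h24 : a2 = a4 * δ := by
    have h1 := congrArg (inner ℂ (γ e₂)) (ha.symm.trans ha')
    rw [hq, hq', hβ, hδ] at h1
    simpa only [inner_add_right, inner_smul_right, f21, f22, f23, mul_zero, mul_one, zero_add,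
      add_zero] using h1
  have h13' : a1 • γ (e₁ + y • e₃) = a3 • γ (α • (e₁ + c • e₂) + y • e₃) := by
    have h1 := ha.symm.trans ha'
    rw [hδ, smul_smul, ← h24] at h1
    exact add_right_cancel h1
  -- Otherwise γ v spans the line of γ e₂; splitting v as (e₁+x•e₂)+y•e₃ then puts γ(e₁+x•e₂) on
  -- that line, against `hx`.
  have ha1 : a1 ≠ 0 := by
    rintro rfl
    rw [zero_smul, zero_add] at ha
    have h1 := congrArg (inner ℂ (γ e₃)) (ha.symm.trans ha'')
    rw [hrs] at h1
    have ha6 : a6 = 0 := by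
      simpa only [inner_add_right, inner_smul_right, f31, f32, f33, mul_zero, mul_one, zero_add,
        add_zero] using h1.symm
    rw [ha6, zero_smul, add_zero] at ha''
    exact hx ((hγ.span_eq hv0 ha'').symm.trans (hγ.span_eq hv0 ha))
  have hfin : γ (e₁ + y • e₃) = (a1⁻¹ * a3) • γ (α • (e₁ + c • e₂) + y • e₃) := by
    rw [mul_smul, ← h13', smul_smul, inv_mul_cancel₀ ha1, one_smul]
  rw [hγ.span_eq (add_smul_ne_zero n1 (by rw [inner_smul_right, h13, mul_zero])) hfin]
  have e : α • (e₁ + c • e₂) + y • e₃ =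
      α • (e₁ + c • e₂ + (y * (1 + conj c * c) / (1 + conj c * x)) • e₃) := by
    have : α * (y * (1 + conj c * c) / (1 + conj c * x)) = y := by
      rw [hαdef]
      field_simp
    rw [smul_add α (e₁ + c • e₂), smul_smul, this]
  rw [e, hγ.span_smul hα0]

/-- An orthogonality preserving map of a complex projective plane does not identify two lines. -/
theorem IsRayMap.not_collapse (hγ : IsRayMap γ) (n1 : ‖e₁‖ = 1) (n2 : ‖e₂‖ = 1) (n3 : ‖e₃‖ = 1)
    (h12 : inner ℂ e₁ e₂ = 0) (h13 : inner ℂ e₁ e₃ = 0) (h23 : inner ℂ e₂ e₃ = 0) {c : ℂ}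
    (hc : c ≠ 0) : (ℂ ∙ γ (e₁ + c • e₂)) ≠ ℂ ∙ γ e₁ := by
  intro hb
  have i1 : inner ℂ e₁ e₁ = (1 : ℂ) := by rw [inner_self_eq_norm_sq_to_K, n1]; simp
  have i2 : inner ℂ e₂ e₂ = (1 : ℂ) := by rw [inner_self_eq_norm_sq_to_K, n2]; simp
  have i3 : inner ℂ e₃ e₃ = (1 : ℂ) := by rw [inner_self_eq_norm_sq_to_K, n3]; simp
  have h21 : inner ℂ e₂ e₁ = 0 := inner_eq_zero_symm.1 h12
  have h31 : inner ℂ e₃ e₁ = 0 := inner_eq_zero_symm.1 h13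
  have ne1 : e₁ ≠ 0 := norm_ne_zero_iff.1 (by simp [n1])
  have ne2 : e₂ ≠ 0 := norm_ne_zero_iff.1 (by simp [n2])
  have not_span_eq : ∀ {v w : H}, v ≠ 0 → w ≠ 0 → inner ℂ v w = 0 → (ℂ ∙ γ v) ≠ ℂ ∙ γ w := by
    intro v w hv hw hvw h
    obtain ⟨d, hd⟩ := exists_smul_of_span_eq h.symm
    have := hγ.orth _ _ hvw
    rw [hd, inner_smul_right, hγ.inner_self hv, mul_one] at this
    exact hγ.ne_zero hw (by rw [hd, this, zero_smul])
  have hne : ∀ x : ℂ, e₁ + x • e₂ ≠ 0 := fun x =>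
    add_smul_ne_zero n1 (by rw [inner_smul_right, h12, mul_zero])
  have hne3 : ∀ x : ℂ, e₁ + x • e₃ ≠ 0 := fun x =>
    add_smul_ne_zero n1 (by rw [inner_smul_right, h13, mul_zero])
  have step := fun {x : ℂ} (hx : (ℂ ∙ γ (e₁ + x • e₂)) ≠ ℂ ∙ γ e₂) =>
    hγ.collapse_step n1 n2 n3 h12 h13 h23 hb hx
  have h12' := not_span_eq ne1 ne2 h12
  have step0 := (step (x := 0) (by simpa using h12')).2
  obtain ⟨hQ, stepc⟩ := step (x := c) (by rw [hb]; exact h12')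
  set Q := 1 + conj c * c with hQdef
  -- The multipliers z that do not change images on the line through e₁ and e₃ form a multiplicative
  -- set. Comparing `step` at x with `step` at 0 puts 1+conj c*x in it. It has no negative real r,
  -- since y = 1/√(-r) would give orthogonal vectors with equal images.
  let P : ℂ → Prop := fun z => ∀ y : ℂ, (ℂ ∙ γ (e₁ + y • e₃)) = ℂ ∙ γ (e₁ + (z * y) • e₃)
  have hPadm : ∀ x, (ℂ ∙ γ (e₁ + x • e₂)) ≠ ℂ ∙ γ e₂ → P (1 + conj c * x) := by
    intro x hx y
    obtain ⟨hx0, hs⟩ := step hx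
    have h1 := hs ((1 + conj c * x) * y)
    rw [show (1 + conj c * x) * y * Q / (1 + conj c * x) = y * Q by field_simp] at h1
    have h2 := step0 y
    rw [mul_zero, add_zero, div_one] at h2
    exact h2.trans h1.symm
  refine false_of_mul_closed P ?_ ?_ (k := Complex.normSq c) (Complex.normSq_pos.2 hc) ?_
  · intro a b ha hb y
    rw [hb y, ha (b * y), mul_assoc]
  · intro r hr hPr
    have hr' : 0 < -r := by linarith
    have hs : 0 < Real.sqrt (-r) := Real.sqrt_pos.2 hr'
    have hsq : Real.sqrt (-r) * Real.sqrt (-r) = -r := Real.mul_self_sqrt hr'.le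
    refine not_span_eq (hne3 _) (hne3 _) ?_ (hPr ((Real.sqrt (-r))⁻¹ : ℝ))
    simp only [inner_add_left, inner_add_right, inner_smul_left, inner_smul_right, h13, h31, i1,
      i3, Complex.conj_ofReal]
    have : (1 : ℝ) + r * (Real.sqrt (-r))⁻¹ * (Real.sqrt (-r))⁻¹ = 0 := by
      field_simp
      nlinarith
    norm_num
    exact_mod_cast this
  · intro u hu
    have hcc : conj c ≠ 0 := by simpa using hc
    have hu1 : u - 1 ≠ 0 := sub_ne_zero.2 hu
    have hu1' : conj u - 1 ≠ 0 := by
      intro h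
      have := congrArg conj h
      exact hu1 (by simpa using this)
    set x := (u - 1) / conj c with hx
    have hx0 : x ≠ 0 := div_ne_zero hu1 hcc
    by_cases h : (ℂ ∙ γ (e₁ + x • e₂)) = ℂ ∙ γ e₂
    · right
      -- This vector is orthogonal to e₁+x•e₂, so they cannot both have the image of e₂; its
      -- multiplier is 1-|c|²/(conj u-1).
      have h' : (ℂ ∙ γ (e₁ + (-(conj x)⁻¹) • e₂)) ≠ ℂ ∙ γ e₂ := by
        intro h2
        refine not_span_eq (hne _) (hne _) ?_ (h.trans h2.symm)
        have : conj x ≠ 0 := by simpa using hx0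
        simp only [inner_add_left, inner_add_right, inner_smul_left, inner_smul_right, h12, h21,
          i1, i2]
        field_simp
        ring
      have := hPadm _ h'
      convert this using 2
      rw [hx, Complex.normSq_eq_conj_mul_self]
      simp only [map_div₀, map_sub, map_one, Complex.conj_conj]
      field_simp
      ring
    · left
      have := hPadm x h
      rwa [hx, mul_div_cancel₀ _ hcc, add_sub_cancel] at this

end Collapse

end RayMaps

-- The affine chart at a unit vector and the isometry built from it.

section RayLift

open ComplexConjugate

variable {H : Type*} [NormedAddCommGroup H] [InnerProductSpace ℂ H]

theorem exists_unit_orthogonal_four (hdim : ((4 : ℕ) : Cardinal) < Module.rank ℂ H) (e a b c : H) :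
    ∃ x : H, ‖x‖ = 1 ∧ inner ℂ e x = 0 ∧ inner ℂ a x = 0 ∧ inner ℂ b x = 0 ∧ inner ℂ c x = 0 := by
  have h := (finrank_span_le_card (R := ℂ) ({e} : Set H)).trans_eq (by simp : _ = 1)
  obtain ⟨x, hx, hx1, hax, hbx, hcx⟩ := exists_unit_orthogonal_three (ℂ ∙ e)
    (lt_of_le_of_lt (by exact_mod_cast (by omega)) hdim) a b c
  exact ⟨x, hx1, Submodule.mem_orthogonal_singleton_iff_inner_right.1 hx, hax, hbx, hcx⟩

variable {γ : H → H}

/-- The vector `u` orthogonal to `γ e` such that `γ (e + w)` is proportional to `γ e + u`. -/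
noncomputable def rayLift (γ : H → H) (e w : H) : H :=
  (inner ℂ (γ e) (γ (e + w)))⁻¹ • γ (e + w) - γ e

variable {e : H}

/-- The inverse in `rayLift` is genuine: if γ(e+w) had no component along γ e, the lines of e+w and
w would have the same image, contrary to `IsRayMap.not_collapse`. -/
theorem IsRayMap.exists_add_rayLift (hγ : IsRayMap γ)
    (hdim : ((4 : ℕ) : Cardinal) < Module.rank ℂ H) (he : ‖e‖ = 1) {w : H}
    (hw : inner ℂ e w = 0) :
    (∃ p : ℂ, γ e + rayLift γ e w = p • γ (e + w)) ∧ (∃ d : ℂ, rayLift γ e w = d • γ w) := by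
  have he0 : e ≠ 0 := norm_ne_zero_iff.1 (by simp [he])
  obtain ⟨a, b, hab⟩ := hγ.add e w hw
  have ha : inner ℂ (γ e) (γ (e + w)) = a := by
    rw [hab, inner_add_right, inner_smul_right, inner_smul_right, hγ.orth _ _ hw,
      hγ.inner_self he0, mul_one, mul_zero, add_zero]
  have ha0 : a ≠ 0 := by
    rintro rfl
    rw [zero_smul, zero_add] at hab
    have hne : e + w ≠ 0 := add_smul_ne_zero he hw
    have hw0 : w ≠ 0 := by
      rintro rfl
      exact hγ.ne_zero hne (by rw [hab, hγ.zero, smul_zero])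
    have hn : (‖w‖ : ℂ) ≠ 0 := by exact_mod_cast norm_ne_zero_iff.2 hw0
    obtain ⟨x, hx1, hex, hwx, -⟩ := exists_unit_orthogonal_four hdim e w w w
    have hwn : ‖(‖w‖ : ℂ)⁻¹ • w‖ = 1 := by
      rw [norm_smul, norm_inv, Complex.norm_real, norm_norm,
        inv_mul_cancel₀ (norm_ne_zero_iff.2 hw0)]
    refine hγ.not_collapse (e₁ := (‖w‖ : ℂ)⁻¹ • w) (e₂ := e) (e₃ := x) hwn he hx1
      (by rw [inner_smul_left, inner_eq_zero_symm.1 hw, mul_zero])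
      (by rw [inner_smul_left, hwx, mul_zero]) hex (inv_ne_zero hn) ?_
    rw [← smul_add, hγ.span_smul (inv_ne_zero hn), hγ.span_smul (inv_ne_zero hn), add_comm]
    exact hγ.span_eq hne hab
  refine ⟨⟨a⁻¹, by rw [rayLift, ha]; abel⟩, a⁻¹ * b, ?_⟩
  rw [rayLift, ha, hab, smul_add, smul_smul, inv_mul_cancel₀ ha0, one_smul, smul_smul]
  abel

theorem IsRayMap.inner_rayLift (hγ : IsRayMap γ)
    (hdim : ((4 : ℕ) : Cardinal) < Module.rank ℂ H) (he : ‖e‖ = 1) {w : H}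
    (hw : inner ℂ e w = 0) : inner ℂ (γ e) (rayLift γ e w) = 0 := by
  obtain ⟨-, d, hd⟩ := hγ.exists_add_rayLift hdim he hw
  rw [hd, inner_smul_right, hγ.orth _ _ hw, mul_zero]

theorem IsRayMap.rayLift_zero (hγ : IsRayMap γ) (he : ‖e‖ = 1) : rayLift γ e 0 = 0 := by
  have he0 : e ≠ 0 := norm_ne_zero_iff.1 (by simp [he])
  rw [rayLift, add_zero, hγ.inner_self he0, inv_one, one_smul, sub_self]

theorem IsRayMap.one_add_inner_rayLift (hγ : IsRayMap γ)
    (hdim : ((4 : ℕ) : Cardinal) < Module.rank ℂ H) (he : ‖e‖ = 1) {v w : H}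
    (hv : inner ℂ e v = 0) (hw : inner ℂ e w = 0) (h : 1 + inner ℂ v w = (0 : ℂ)) :
    1 + inner ℂ (rayLift γ e v) (rayLift γ e w) = (0 : ℂ) := by
  have he0 : e ≠ 0 := norm_ne_zero_iff.1 (by simp [he])
  obtain ⟨⟨p, hp⟩, -⟩ := hγ.exists_add_rayLift hdim he hv
  obtain ⟨⟨q, hq⟩, -⟩ := hγ.exists_add_rayLift hdim he hw
  have h1 : inner ℂ (e + v) (e + w) = (0 : ℂ) := by
    rw [inner_add_left, inner_add_right, inner_add_right, hw, inner_eq_zero_symm.1 hv,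
      inner_self_eq_norm_sq_to_K, he]
    simpa using h
  have h2 : inner ℂ (γ e + rayLift γ e v) (γ e + rayLift γ e w) = (0 : ℂ) := by
    rw [hp, hq, inner_smul_left, inner_smul_right, hγ.orth _ _ h1]
    simp
  rw [inner_add_left, inner_add_right, inner_add_right, hγ.inner_rayLift hdim he hw,
    inner_eq_zero_symm.1 (hγ.inner_rayLift hdim he hv), hγ.inner_self he0] at h2
  simpa using h2

/-- Splitting e+v+w as (e+v)+w and as (e+w)+v shows that the lift of v+w differs from that of v by a
multiple of γ w, and from that of w by a multiple of γ v. Comparing components along γ w fixes the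
multiple. -/
theorem IsRayMap.rayLift_add_of_inner_eq_zero (hγ : IsRayMap γ)
    (hdim : ((4 : ℕ) : Cardinal) < Module.rank ℂ H) (he : ‖e‖ = 1) {v w : H}
    (hv : inner ℂ e v = 0) (hw : inner ℂ e w = 0) (hvw : inner ℂ v w = 0) :
    rayLift γ e (v + w) = rayLift γ e v + rayLift γ e w := by
  have he0 : e ≠ 0 := norm_ne_zero_iff.1 (by simp [he])
  have key : ∀ {v w : H}, inner ℂ e v = 0 → inner ℂ e w = 0 → inner ℂ v w = 0 →
      ∃ b : ℂ, rayLift γ e (v + w) = rayLift γ e v + b • γ w := by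
    intro v w hv hw hvw
    have hvw' : inner ℂ e (v + w) = 0 := by rw [inner_add_right, hv, hw, add_zero]
    obtain ⟨⟨p, hp⟩, -⟩ := hγ.exists_add_rayLift hdim he hvw'
    obtain ⟨a, b, hab⟩ := hγ.add (e + v) w (by rw [inner_add_left, hw, hvw, add_zero])
    have hne : e + v ≠ 0 := add_smul_ne_zero he hv
    have hfv := hγ.inner_rayLift hdim he hv
    have hfvw := hγ.inner_rayLift hdim he hvw'
    have hfw := hγ.orth _ _ hw
    have hsub : (inner ℂ (γ e) (γ (e + v))) ≠ 0 := by
      intro h0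
      obtain ⟨⟨q, hq⟩, -⟩ := hγ.exists_add_rayLift hdim he hv
      have := congrArg (inner ℂ (γ e)) hq
      rw [inner_add_right, hγ.inner_self he0, hfv, inner_smul_right, h0] at this
      simp at this
    have hv' : γ (e + v) = inner ℂ (γ e) (γ (e + v)) • (γ e + rayLift γ e v) := by
      rw [rayLift, add_sub_cancel, smul_smul, mul_inv_cancel₀ hsub, one_smul]
    rw [← add_assoc, hab, hv', smul_add, smul_smul, smul_smul, smul_smul] at hp
    set t := p * a * inner ℂ (γ e) (γ (e + v)) with ht
    have h1 := congrArg (inner ℂ (γ e)) hp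
    rw [inner_add_right, hfvw, inner_add_right, inner_smul_right, inner_smul_right,
      inner_add_right, hγ.inner_self he0, hfv, hfw] at h1
    have ht1 : t = 1 := by
      simpa using h1.symm
    rw [ht1, one_smul, add_assoc] at hp
    exact ⟨p * b, add_left_cancel hp⟩
  obtain ⟨b, hb⟩ := key hv hw hvw
  obtain ⟨c, hc⟩ := key hw hv (inner_eq_zero_symm.1 hvw)
  obtain ⟨-, d, hd⟩ := hγ.exists_add_rayLift hdim he hv
  obtain ⟨-, d', hd'⟩ := hγ.exists_add_rayLift hdim he hw
  rw [add_comm w v] at hc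
  have h1 := hb.symm.trans hc
  rw [hd, hd'] at h1
  rw [hb, hd']
  by_cases hw0 : w = 0
  · rw [hw0, hγ.zero, smul_zero, smul_zero]
  have h2 := congrArg (inner ℂ (γ w)) h1
  simp only [inner_add_right, inner_smul_right, hγ.inner_self hw0,
    hγ.orth _ _ (inner_eq_zero_symm.1 hvw), mul_zero, mul_one, zero_add, add_zero] at h2
  rw [h2]

/-- The restriction of `rayLift γ e` to the line of the unit vector `u` is semilinear. -/
def IsSemilinearOn (γ : H → H) (e : H) (σ : ℂ →+* ℂ) (u : H) : Prop :=
  (∀ x : ℂ, rayLift γ e (x • u) = σ x • rayLift γ e u) ∧ ‖rayLift γ e u‖ = 1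

theorem IsRayMap.exists_isSemilinearOn (hγ : IsRayMap γ)
    (hdim : ((4 : ℕ) : Cardinal) < Module.rank ℂ H) (he : ‖e‖ = 1) {u v : H}
    (hu : inner ℂ e u = 0) (hv : inner ℂ e v = 0) (hu1 : ‖u‖ = 1) (hv1 : ‖v‖ = 1)
    (huv : inner ℂ u v = 0) :
    ∃ σ : ℂ →+* ℂ, (σ = RingHom.id ℂ ∨ σ = starRingEnd ℂ) ∧ IsSemilinearOn γ e σ u ∧
      IsSemilinearOn γ e σ v := by
  have hu0 : u ≠ 0 := norm_ne_zero_iff.1 (by simp [hu1])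
  have hv0 : v ≠ 0 := norm_ne_zero_iff.1 (by simp [hv1])
  have hcoord : ∀ {u : H}, inner ℂ e u = 0 → ∀ x : ℂ, ∃ j : ℂ, rayLift γ e (x • u) = j • γ u := by
    intro u hu x
    obtain ⟨-, d, hd⟩ := hγ.exists_add_rayLift hdim he (w := x • u)
      (by rw [inner_smul_right, hu, mul_zero])
    obtain ⟨d', hd'⟩ := hγ.smul x u
    exact ⟨d * d', by rw [hd, hd', smul_smul]⟩
  choose j hj using hcoord hu
  choose h hh using hcoord hv
  have hj0 : j 0 = 0 := by
    have := hj 0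
    rw [zero_smul, hγ.rayLift_zero he] at this
    exact (smul_eq_zero.1 this.symm).resolve_right (hγ.ne_zero hu0)
  have hh0 : h 0 = 0 := by
    have := hh 0
    rw [zero_smul, hγ.rayLift_zero he] at this
    exact (smul_eq_zero.1 this.symm).resolve_right (hγ.ne_zero hv0)
  have hvu := inner_eq_zero_symm.1 huv
  have huu : inner ℂ u u = (1 : ℂ) := by rw [inner_self_eq_norm_sq_to_K, hu1]; simp
  have hvv : inner ℂ v v = (1 : ℂ) := by rw [inner_self_eq_norm_sq_to_K, hv1]; simp
  have hadd : ∀ a c : ℂ, rayLift γ e (a • u + c • v) = j a • γ u + h c • γ v := by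
    intro a c
    rw [hγ.rayLift_add_of_inner_eq_zero hdim he (by rw [inner_smul_right, hu, mul_zero])
      (by rw [inner_smul_right, hv, mul_zero])
      (by rw [inner_smul_right, inner_smul_left, huv, mul_zero, mul_zero]), hj, hh]
  obtain ⟨σ, hσ, hjσ, hhσ, hj1, hh1⟩ := exists_ringHom_of_coordinates hj0 hh0 (by
    intro a b c d habcd
    have hperp : ∀ a c : ℂ, inner ℂ e (a • u + c • v) = 0 := by
      intro a c
      rw [inner_add_right, inner_smul_right, inner_smul_right, hu, hv, mul_zero, mul_zero, add_zero]
    have h1 := hγ.one_add_inner_rayLift hdim he (hperp a c) (hperp b d) (by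
      simp only [inner_add_left, inner_add_right, inner_smul_left, inner_smul_right, huu, hvv,
        huv, hvu]
      linear_combination habcd)
    rw [hadd, hadd] at h1
    simp only [inner_add_left, inner_add_right, inner_smul_left, inner_smul_right,
      hγ.inner_self hu0, hγ.inner_self hv0, hγ.orth _ _ huv, hγ.orth _ _ hvu] at h1
    linear_combination h1)
  have hj' := hj 1
  have hh' := hh 1
  rw [one_smul] at hj' hh'
  refine ⟨σ, hσ, ⟨fun x => ?_, ?_⟩, ⟨fun x => ?_, ?_⟩⟩
  · rw [hj, hj', smul_smul, ← hjσ]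
  · rw [hj', norm_smul, hj1, hγ.norm _ hu0, one_mul]
  · rw [hh, hh', smul_smul, ← hhσ]
  · rw [hh', norm_smul, hh1, hγ.norm _ hv0, one_mul]

theorem IsSemilinearOn.unique {σ τ : ℂ →+* ℂ} {u : H} (hσ : IsSemilinearOn γ e σ u)
    (hτ : IsSemilinearOn γ e τ u) : σ = τ := by
  ext x
  have h := (hσ.1 x).symm.trans (hτ.1 x)
  have h0 : rayLift γ e u ≠ 0 := norm_ne_zero_iff.1 (by rw [hσ.2]; exact one_ne_zero)
  exact smul_left_injective ℂ h0 h

/-- Orthogonal directions share their σ, and any two directions have a common orthogonal one. -/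
theorem IsRayMap.exists_forall_isSemilinearOn (hγ : IsRayMap γ)
    (hdim : ((4 : ℕ) : Cardinal) < Module.rank ℂ H) (he : ‖e‖ = 1) :
    ∃ σ : ℂ →+* ℂ, (σ = RingHom.id ℂ ∨ σ = starRingEnd ℂ) ∧
      ∀ u : H, inner ℂ e u = 0 → ‖u‖ = 1 → IsSemilinearOn γ e σ u := by
  have transfer : ∀ {σ : ℂ →+* ℂ} {u v : H}, inner ℂ e u = 0 → inner ℂ e v = 0 → ‖u‖ = 1 →
      ‖v‖ = 1 → inner ℂ u v = 0 → IsSemilinearOn γ e σ u → IsSemilinearOn γ e σ v := by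
    intro σ u v hu hv hu1 hv1 huv hσ
    obtain ⟨τ, -, hτ, hτ'⟩ := hγ.exists_isSemilinearOn hdim he hu hv hu1 hv1 huv
    rwa [hσ.unique hτ]
  obtain ⟨u, hu1, hu, -⟩ := exists_unit_orthogonal_four hdim e e e e
  obtain ⟨v, hv1, hv, huv, -⟩ := exists_unit_orthogonal_four hdim e u u u
  obtain ⟨σ, hσ, hσu, -⟩ := hγ.exists_isSemilinearOn hdim he hu hv hu1 hv1 huv
  refine ⟨σ, hσ, fun w hw hw1 => ?_⟩
  obtain ⟨x, hx1, hx, hux, hwx, -⟩ := exists_unit_orthogonal_four hdim e u w w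
  exact transfer hx hw hx1 hw1 (inner_eq_zero_symm.1 hwx) (transfer hu hx hu1 hx1 hux hσu)

/-- A ray map is induced by a linear or conjugate-linear isometry. -/
theorem IsRayMap.exists_isometry (hγ : IsRayMap γ)
    (hdim : ((4 : ℕ) : Cardinal) < Module.rank ℂ H) :
    ∃ σ : ℂ →+* ℂ, (σ = RingHom.id ℂ ∨ σ = starRingEnd ℂ) ∧
      ∃ L : H →ₛₗᵢ[σ] H, ∀ v, ∃ d : ℂ, L v = d • γ v := by
  obtain ⟨e, he, -⟩ := exists_unit_orthogonal_four hdim 0 0 0 0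
  have he0 : e ≠ 0 := norm_ne_zero_iff.1 (by simp [he])
  have hee : inner ℂ e e = (1 : ℂ) := by rw [inner_self_eq_norm_sq_to_K, he]; simp
  obtain ⟨σ, hσ, hgood⟩ := hγ.exists_forall_isSemilinearOn hdim he
  have hσn : ∀ z, ‖σ z‖ = ‖z‖ := by
    rcases hσ with rfl | rfl <;> simp
  set T := rayLift γ e with hT
  have unit : ∀ w : H, w ≠ 0 → ∃ u : H, ‖u‖ = 1 ∧ (‖w‖ : ℂ) • u = w ∧
      (inner ℂ e w = 0 → inner ℂ e u = 0) := by
    intro w hw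
    have hn : (‖w‖ : ℂ) ≠ 0 := by exact_mod_cast norm_ne_zero_iff.2 hw
    refine ⟨(‖w‖ : ℂ)⁻¹ • w, ?_, by rw [smul_smul, mul_inv_cancel₀ hn, one_smul], fun h => ?_⟩
    · rw [norm_smul, norm_inv, Complex.norm_real, norm_norm,
        inv_mul_cancel₀ (norm_ne_zero_iff.2 hw)]
    · rw [inner_smul_right, h, mul_zero]
  have hsmul : ∀ (x : ℂ) (w : H), inner ℂ e w = 0 → T (x • w) = σ x • T w := by
    intro x w hw
    by_cases hw0 : w = 0
    · rw [hw0, smul_zero, hT, hγ.rayLift_zero he, smul_zero]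
    obtain ⟨u, hu1, huw, hu⟩ := unit w hw0
    have hg := hgood u (hu hw) hu1
    generalize (‖w‖ : ℂ) = n at huw
    rw [← huw, smul_smul, hT, hg.1, hg.1, map_mul, mul_smul]
  have hnorm : ∀ w : H, inner ℂ e w = 0 → ‖T w‖ = ‖w‖ := by
    intro w hw
    by_cases hw0 : w = 0
    · rw [hw0, hT, hγ.rayLift_zero he]
    obtain ⟨u, hu1, huw, hu⟩ := unit w hw0
    have hg := hgood u (hu hw) hu1
    rw [← huw, hT, hg.1, norm_smul, norm_smul, hg.2, hu1, hσn]
  have hadd : ∀ v w : H, inner ℂ e v = 0 → inner ℂ e w = 0 → T (v + w) = T v + T w := by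
    intro v w hv hw
    by_cases hv0 : v = 0
    · rw [hv0, zero_add, hT, hγ.rayLift_zero he, zero_add]
    have hvv : inner ℂ v v ≠ (0 : ℂ) := inner_self_ne_zero.2 hv0
    -- With w = c•v+w' and w' ⟂ v, also v+w = (1+c)•v+w', so orthogonal additivity and semilinearity
    -- along v suffice.
    set c : ℂ := inner ℂ v w / inner ℂ v v with hc
    set w' := w - c • v with hw'
    have hvw' : inner ℂ v w' = 0 := by
      rw [hw', inner_sub_right, inner_smul_right, hc, div_mul_cancel₀ _ hvv, sub_self]
    have hew' : inner ℂ e w' = 0 := by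
      rw [hw', inner_sub_right, inner_smul_right, hv, hw, mul_zero, sub_zero]
    have hsplit : ∀ x : ℂ, T (x • v + w') = σ x • T v + T w' := by
      intro x
      rw [← hsmul x v hv]
      exact hγ.rayLift_add_of_inner_eq_zero hdim he (by rw [inner_smul_right, hv, mul_zero]) hew'
        (by rw [inner_smul_left, hvw', mul_zero])
    have h1 := hsplit c
    have h2 := hsplit (1 + c)
    rw [show c • v + w' = w by rw [hw']; abel] at h1
    rw [show (1 + c) • v + w' = v + w by rw [hw']; module] at h2
    rw [h2, h1, map_add, map_one, add_smul, one_smul, add_assoc]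
  have hperp : ∀ v : H, inner ℂ e (v - inner ℂ e v • e) = 0 := by
    intro v
    rw [inner_sub_right, inner_smul_right, hee, mul_one, sub_self]
  let L : H →ₛₗ[σ] H :=
    { toFun := fun v => σ (inner ℂ e v) • γ e + T (v - inner ℂ e v • e)
      map_add' := by
        intro v w
        have : v + w - inner ℂ e (v + w) • e =
            (v - inner ℂ e v • e) + (w - inner ℂ e w • e) := by
          rw [inner_add_right]
          module
        rw [this, hadd _ _ (hperp v) (hperp w), inner_add_right, map_add]
        module
      map_smul' := by
        intro x v
        have : x • v - inner ℂ e (x • v) • e = x • (v - inner ℂ e v • e) := by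
          rw [inner_smul_right]
          module
        rw [this, hsmul _ _ (hperp v), inner_smul_right, map_mul]
        module }
  refine ⟨σ, hσ, ⟨L, fun v => ?_⟩, fun v => ?_⟩
  · change ‖σ (inner ℂ e v) • γ e + T (v - inner ℂ e v • e)‖ = ‖v‖
    have h1 : ‖σ (inner ℂ e v) • γ e + T (v - inner ℂ e v • e)‖ *
        ‖σ (inner ℂ e v) • γ e + T (v - inner ℂ e v • e)‖ =
        ‖inner ℂ e v‖ * ‖inner ℂ e v‖ + ‖v - inner ℂ e v • e‖ * ‖v - inner ℂ e v • e‖ := by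
      rw [norm_add_sq_eq_norm_sq_add_norm_sq_of_inner_eq_zero (𝕜 := ℂ), norm_smul, hσn,
        hγ.norm e he0, mul_one, hnorm _ (hperp v)]
      rw [inner_smul_left, hT, hγ.inner_rayLift hdim he (hperp v), mul_zero]
    have h2 : ‖v‖ * ‖v‖ =
        ‖inner ℂ e v‖ * ‖inner ℂ e v‖ + ‖v - inner ℂ e v • e‖ * ‖v - inner ℂ e v • e‖ := by
      conv_lhs => rw [show v = inner ℂ e v • e + (v - inner ℂ e v • e) by abel]
      rw [norm_add_sq_eq_norm_sq_add_norm_sq_of_inner_eq_zero (𝕜 := ℂ), norm_smul, he, mul_one]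
      rw [inner_smul_left, hperp, mul_zero]
    exact (mul_self_inj (norm_nonneg _) (norm_nonneg _)).1 (h1.trans h2.symm)
  · change ∃ d : ℂ, σ (inner ℂ e v) • γ e + T (v - inner ℂ e v • e) = d • γ v
    set a : ℂ := inner ℂ e v with ha
    by_cases ha0 : a = 0
    · rw [ha0, map_zero, zero_smul, zero_add, zero_smul, sub_zero]
      exact (hγ.exists_add_rayLift hdim he ha0).2
    · have hw : inner ℂ e (a⁻¹ • (v - a • e)) = 0 := by
        rw [inner_smul_right, hperp, mul_zero]
      obtain ⟨⟨p, hp⟩, -⟩ := hγ.exists_add_rayLift hdim he hw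
      obtain ⟨d, hd⟩ := hγ.smul a⁻¹ v
      rw [show e + a⁻¹ • (v - a • e) = a⁻¹ • v by
        rw [smul_sub, smul_smul, inv_mul_cancel₀ ha0, one_smul]; abel, hd] at hp
      -- For a ≠ 0 the vector a⁻¹•v lies in the chart at e, and semilinearity carries the scalar a
      -- out.
      refine ⟨σ a * p * d, ?_⟩
      have h1 : σ a • (γ e + rayLift γ e (a⁻¹ • (v - a • e))) = σ a • γ e + T (v - a • e) := by
        have h2 := hsmul a⁻¹ _ (hperp v)
        rw [← ha] at h2
        rw [← hT, h2, smul_add, smul_smul, ← map_mul, mul_inv_cancel₀ ha0, map_one, one_smul]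
      rw [← h1, hp, smul_smul, smul_smul, mul_assoc]

end RayLift

-- From maps of the Grassmannian to isometries, and back.

section Induced

variable {H : Type*} [NormedAddCommGroup H] [InnerProductSpace ℂ H]

/-- One more descent reaches lines. For v ⟂ w the images of their lines are orthogonal, hence span
the two-dimensional image of their plane, which also contains the image of v+w. -/
theorem IsOrthoMap.exists_isRayMap {F : Submodule ℂ H → Submodule ℂ H} (hF : IsOrthoMap 2 F)
    (hdim : ((4 : ℕ) : Cardinal) < Module.rank ℂ H) :
    ∃ γ : H → H, IsRayMap γ ∧
      ∀ (v : H) (X : Submodule ℂ H), Module.finrank ℂ X = 2 → v ∈ X → γ v ∈ F X := by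
  obtain ⟨G, hG, hGF⟩ := IsOrthoMap.exists_descent (k := 1) hF le_rfl hdim
  have hex : ∀ S : Submodule ℂ H, ∃ u : H, Module.finrank ℂ S = 1 → ‖u‖ = 1 ∧ u ∈ G S := by
    intro S
    by_cases hS : Module.finrank ℂ S = 1
    · obtain ⟨x, hx, hx0⟩ := (Submodule.ne_bot_iff (G S)).1 (fun h => by
        have := hG.finrank_eq S hS
        rw [h, finrank_bot] at this
        exact zero_ne_one this)
      refine ⟨((‖x‖⁻¹ : ℝ) : ℂ) • x, fun _ => ⟨?_, Submodule.smul_mem _ _ hx⟩⟩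
      rw [norm_smul, Complex.norm_real, norm_inv, norm_norm,
        inv_mul_cancel₀ (norm_ne_zero_iff.2 hx0)]
    · exact ⟨0, fun h => absurd h hS⟩
  choose u hu using hex
  classical
  let γ : H → H := fun v => if v = 0 then 0 else u (ℂ ∙ v)
  have γ0 : γ 0 = 0 := if_pos rfl
  have γv : ∀ {v}, v ≠ 0 → γ v = u (ℂ ∙ v) := fun h => if_neg h
  have hle : ∀ (v : H) (X : Submodule ℂ H), Module.finrank ℂ X = 2 → v ∈ X → γ v ∈ F X := by
    intro v X hX hv
    by_cases hv0 : v = 0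
    · rw [hv0, γ0]; exact Submodule.zero_mem _
    · rw [γv hv0]
      exact hGF _ X (finrank_span_singleton hv0) hX ((Submodule.span_singleton_le_iff_mem _ _).2 hv)
        (hu _ (finrank_span_singleton hv0)).2
  have hnorm : ∀ v, v ≠ 0 → ‖γ v‖ = 1 := fun v hv => by
    rw [γv hv]
    exact (hu _ (finrank_span_singleton hv)).1
  have horth : ∀ v w, inner ℂ v w = 0 → inner ℂ (γ v) (γ w) = 0 := by
    intro v w h
    by_cases hv : v = 0
    · rw [hv, γ0, inner_zero_left]
    by_cases hw : w = 0
    · rw [hw, γ0, inner_zero_right]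
    rw [γv hv, γv hw]
    exact (hG.isOrtho _ _ (finrank_span_singleton hv) (finrank_span_singleton hw)
      (isOrtho_span_singleton_span_singleton.2 h)).inner_eq (hu _ (finrank_span_singleton hv)).2
      (hu _ (finrank_span_singleton hw)).2
  refine ⟨γ, ⟨γ0, hnorm, horth, ?_, ?_⟩, hle⟩
  · intro c v
    by_cases hv : v = 0
    · exact ⟨0, by rw [hv, smul_zero, γ0, smul_zero]⟩
    by_cases hc : c = 0
    · exact ⟨0, by rw [hc, zero_smul, γ0, zero_smul]⟩
    refine ⟨1, ?_⟩
    rw [one_smul, γv hv, γv (smul_ne_zero hc hv), Submodule.span_singleton_smul_eq (Ne.isUnit hc)]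
  · intro v w h
    by_cases hv : v = 0
    · exact ⟨0, 1, by rw [hv, zero_add, zero_smul, one_smul, zero_add]⟩
    by_cases hw : w = 0
    · exact ⟨1, 0, by rw [hw, add_zero, zero_smul, one_smul, add_zero]⟩
    have span2 : ∀ {v w : H}, v ≠ 0 → w ≠ 0 → inner ℂ v w = 0 →
        Module.finrank ℂ ((ℂ ∙ v) ⊔ ℂ ∙ w : Submodule ℂ H) = 2 := by
      intro v w hv hw h
      rw [finrank_sup_span_singleton hw
        (Submodule.mem_orthogonal_singleton_iff_inner_right.2 h), finrank_span_singleton hv]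
    have hX := span2 hv hw h
    have hY := span2 (norm_ne_zero_iff.1 (by simp [hnorm v hv]))
      (norm_ne_zero_iff.1 (by simp [hnorm w hw])) (horth v w h)
    have hvX : v ∈ ((ℂ ∙ v) ⊔ ℂ ∙ w : Submodule ℂ H) :=
      Submodule.mem_sup_left (Submodule.mem_span_singleton_self v)
    have hwX : w ∈ ((ℂ ∙ v) ⊔ ℂ ∙ w : Submodule ℂ H) :=
      Submodule.mem_sup_right (Submodule.mem_span_singleton_self w)
    have := hF.finiteDimensional two_pos hX
    have heq : (ℂ ∙ γ v) ⊔ (ℂ ∙ γ w) = F ((ℂ ∙ v) ⊔ ℂ ∙ w) := by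
      refine Submodule.eq_of_le_of_finrank_eq (sup_le ?_ ?_) (by rw [hY, hF.finrank_eq _ hX])
      · exact (Submodule.span_singleton_le_iff_mem _ _).2 (hle _ _ hX hvX)
      · exact (Submodule.span_singleton_le_iff_mem _ _).2 (hle _ _ hX hwX)
    have hmem := hle _ _ hX (Submodule.add_mem _ hvX hwX)
    rw [← heq] at hmem
    obtain ⟨y, hy, z, hz, hyz⟩ := Submodule.mem_sup.1 hmem
    obtain ⟨a, rfl⟩ := Submodule.mem_span_singleton.1 hy
    obtain ⟨b, rfl⟩ := Submodule.mem_span_singleton.1 hz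
    exact ⟨a, b, hyz.symm⟩

section Isometry

variable {σ : ℂ →+* ℂ} [RingHomSurjective σ] (L : H →ₛₗᵢ[σ] H)

theorem finrank_map_isometry (X : Submodule ℂ H) :
    Module.finrank ℂ (X.map L.toLinearMap) = Module.finrank ℂ X := by
  let φ : X →+ X.map L.toLinearMap :=
    { toFun := fun x => ⟨L x, x, x.2, rfl⟩
      map_zero' := Subtype.ext (map_zero L)
      map_add' := fun x y => Subtype.ext (map_add L (x : H) y) }
  have hφ : Function.Bijective φ := by
    refine ⟨fun x y hxy => Subtype.ext (L.injective (congrArg Subtype.val hxy)), ?_⟩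
    rintro ⟨_, x, hx, rfl⟩
    exact ⟨⟨x, hx⟩, rfl⟩
  exact congrArg Cardinal.toNat (rank_eq_of_equiv_equiv (R := ℂ) (R' := ℂ) σ
    (AddEquiv.ofBijective φ hφ) ⟨σ.injective, RingHomSurjective.is_surjective⟩
    fun r x => Subtype.ext (map_smulₛₗ L r (x : H))).symm

/-- Norms determine real parts of inner products; the imaginary part is reached by applying this to
c•y with σ c = I. -/
theorem inner_map_eq_zero {x y : H} (h : inner ℂ x y = 0) : inner ℂ (L x) (L y) = 0 := by
  have hre : ∀ z : H, inner ℂ x z = 0 → (inner ℂ (L x) (L z)).re = 0 := by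
    intro z hz
    have h1 := norm_add_sq (𝕜 := ℂ) (L x) (L z)
    have h2 := norm_add_sq (𝕜 := ℂ) x z
    rw [← map_add, L.norm_map, L.norm_map, L.norm_map, h2, hz] at h1
    simp only [map_zero, mul_zero, add_zero] at h1
    have : RCLike.re (inner ℂ (L x) (L z)) = 0 := by linarith
    exact this
  obtain ⟨c, hc⟩ := RingHomSurjective.is_surjective (σ := σ) Complex.I
  have h1 := hre (c • y) (by rw [inner_smul_right, h, mul_zero])
  rw [map_smulₛₗ, hc, inner_smul_right, Complex.I_mul_re, neg_eq_zero] at h1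
  exact Complex.ext (hre y h) h1

end Isometry

theorem span_eq_of_eq_topologicalClosure {X : Submodule ℂ H} [FiniteDimensional ℂ X] {S : Set H}
    (h : X = (Submodule.span ℂ S).topologicalClosure) : X = Submodule.span ℂ S := by
  have hle : Submodule.span ℂ S ≤ X := h ▸ Submodule.le_topologicalClosure _
  have := Submodule.finiteDimensional_of_le hle
  rw [(Submodule.span ℂ S).closed_of_finiteDimensional.submodule_topologicalClosure_eq] at h
  exact h

section Compatible

variable [CompleteSpace H]

/-- Completeness enters here: a Hilbert basis of the orthogonal complement of C completes it. -/
theorem exists_isOrthogonalBasis_superset {C : Set H} (h0 : (0 : H) ∉ C)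
    (hC : ∀ x ∈ C, ∀ y ∈ C, x ≠ y → inner ℂ x y = 0) : ∃ B, IsOrthogonalBasis B ∧ C ⊆ B := by
  obtain ⟨w, b, hb⟩ := exists_hilbertBasis ℂ (Submodule.span ℂ C)ᗮ
  have horth : Orthonormal ℂ ((↑) : w → (Submodule.span ℂ C)ᗮ) := hb ▸ b.orthonormal
  have hCD : ∀ x ∈ C, ∀ y : (Submodule.span ℂ C)ᗮ, inner ℂ x (y : H) = 0 := fun x hx y =>
    (Submodule.mem_orthogonal _ _).1 y.2 x (Submodule.subset_span hx)
  refine ⟨C ∪ Subtype.val '' w, ⟨?_, ?_, ?_⟩, Set.subset_union_left⟩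
  · rintro (h | ⟨y, hy, hy0⟩)
    · exact h0 h
    · exact horth.ne_zero ⟨y, hy⟩ (Subtype.ext hy0)
  · rintro x (hx | ⟨x, hx, rfl⟩) y (hy | ⟨y, hy, rfl⟩) hxy
    · exact hC x hx y hy hxy
    · exact hCD x hx y
    · exact inner_eq_zero_symm.1 (hCD y hy x)
    · exact horth.2 (i := ⟨x, hx⟩) (j := ⟨y, hy⟩) fun h =>
        hxy (congrArg (fun z : w => ((z : (Submodule.span ℂ C)ᗮ) : H)) h)
  · rw [Submodule.topologicalClosure_eq_top_iff, Submodule.eq_bot_iff]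
    intro x hx
    rw [Submodule.mem_orthogonal] at hx
    have hxC : x ∈ (Submodule.span ℂ C)ᗮ := (Submodule.mem_orthogonal _ _).2 fun y hy =>
      hx y (Submodule.span_mono Set.subset_union_left hy)
    have hd := b.dense_span
    rw [Submodule.topologicalClosure_eq_top_iff, Submodule.eq_bot_iff, hb, Subtype.range_coe] at hd
    have := hd ⟨x, hxC⟩ (by
      rw [Submodule.mem_orthogonal]
      intro y hy
      induction hy using Submodule.span_induction with
      | mem y hy => exact hx y (Submodule.subset_span (Or.inr ⟨y, hy, rfl⟩))
      | zero => exact inner_zero_left _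
      | add y z _ _ hy hz => rw [inner_add_left, hy, hz, add_zero]
      | smul c y _ hy => rw [inner_smul_left, hy, mul_zero])
    exact congrArg Subtype.val this

theorem compatible_of_orthogonal_set {C S T : Set H} (h0 : (0 : H) ∉ C)
    (hC : ∀ x ∈ C, ∀ y ∈ C, x ≠ y → inner ℂ x y = 0) (hS : S ⊆ C) (hT : T ⊆ C)
    {X Y : Submodule ℂ H} [FiniteDimensional ℂ X] [FiniteDimensional ℂ Y]
    (hX : X = Submodule.span ℂ S) (hY : Y = Submodule.span ℂ T) : Compatible X Y := by
  obtain ⟨B, hB, hCB⟩ := exists_isOrthogonalBasis_superset h0 hC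
  refine ⟨B, hB, ⟨S, hS.trans hCB, ?_⟩, ⟨T, hT.trans hCB, ?_⟩⟩
  · rw [← hX]
    exact X.closed_of_finiteDimensional.submodule_topologicalClosure_eq.symm
  · rw [← hY]
    exact Y.closed_of_finiteDimensional.submodule_topologicalClosure_eq.symm

theorem compatible_sup_span_singleton {S : Submodule ℂ H} [FiniteDimensional ℂ S] {a b : H}
    (ha0 : a ≠ 0) (hb0 : b ≠ 0) (ha : a ∈ Sᗮ) (hb : b ∈ Sᗮ) (hab : inner ℂ a b = 0) :
    Compatible (S ⊔ ℂ ∙ a) (S ⊔ ℂ ∙ b) := by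
  set u := stdOrthonormalBasis ℂ S with hu
  set R : Set H := Set.range fun i => (u i : H) with hR
  have hspan : Submodule.span ℂ R = S := by
    have h1 := congrArg (Submodule.map S.subtype) u.toBasis.span_eq
    rw [Submodule.map_span, Submodule.map_top, Submodule.range_subtype, ← Set.range_comp] at h1
    rw [← h1, hR]
    congr 2
  have hRS : ∀ x ∈ R, x ∈ S := by
    rintro _ ⟨i, rfl⟩
    exact (u i).2
  have hRa : ∀ c ∈ Sᗮ, ∀ x ∈ R, inner ℂ x c = 0 := fun c hc x hx =>
    (Submodule.mem_orthogonal _ _).1 hc x (hRS x hx)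
  refine compatible_of_orthogonal_set (C := R ∪ {a, b}) (S := R ∪ {a}) (T := R ∪ {b}) ?_ ?_
    (Set.union_subset_union_right _ (by simp)) (Set.union_subset_union_right _ (by simp)) ?_ ?_
  · rintro (⟨i, hi⟩ | h | h)
    · exact u.orthonormal.ne_zero i (Subtype.ext hi)
    · exact ha0 h.symm
    · exact hb0 h.symm
  · have sw : ∀ {x y : H}, inner ℂ x y = 0 → inner ℂ y x = 0 := fun h => inner_eq_zero_symm.1 h
    rintro x (hx | rfl | rfl) y (hy | rfl | rfl) hxy
    · obtain ⟨i, rfl⟩ := hx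
      obtain ⟨j, rfl⟩ := hy
      exact u.orthonormal.2 fun h => hxy (by rw [h])
    · exact hRa _ ha _ hx
    · exact hRa _ hb _ hx
    · exact sw (hRa _ ha _ hy)
    · exact absurd rfl hxy
    · exact hab
    · exact sw (hRa _ hb _ hy)
    · exact sw hab
    · exact absurd rfl hxy
  · rw [Submodule.span_union, hspan]
  · rw [Submodule.span_union, hspan]

theorem orthoAdjacent_of_map {k : ℕ} {σ : ℂ →+* ℂ} [RingHomSurjective σ] (L : H →ₛₗᵢ[σ] H)
    {X Y X' Y' : Gr k H} (h : OrthoAdjacent X Y) (hX : X'.1 = X.1.map L.toLinearMap)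
    (hY : Y'.1 = Y.1.map L.toLinearMap) : OrthoAdjacent X' Y' := by
  obtain ⟨hadj, B, ⟨hB0, hB, -⟩, ⟨S, hSB, hS⟩, ⟨T, hTB, hT⟩⟩ := h
  have := X.2.1
  have := Y.2.1
  have := X'.2.1
  have := Y'.2.1
  constructor
  · unfold Adjacent at *
    rw [hX, hY, ← Submodule.map_inf _ L.injective, finrank_map_isometry, hadj]
  · refine compatible_of_orthogonal_set (C := L '' B) (S := L '' S) (T := L '' T) ?_ ?_
      (Set.image_mono hSB) (Set.image_mono hTB) ?_ ?_
    · rintro ⟨x, hx, hx0⟩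
      rw [map_eq_zero_iff L L.injective] at hx0
      exact hB0 (hx0 ▸ hx)
    · rintro _ ⟨x, hx, rfl⟩ _ ⟨y, hy, rfl⟩ hxy
      exact inner_map_eq_zero L (hB x hx y hy fun h => hxy (by rw [h]))
    · rw [hX, span_eq_of_eq_topologicalClosure hS, Submodule.map_span]
      rfl
    · rw [hY, span_eq_of_eq_topologicalClosure hT, Submodule.map_span]
      rfl

end Compatible

theorem adjacent_of_map {k : ℕ} {σ : ℂ →+* ℂ} [RingHomSurjective σ] (L : H →ₛₗᵢ[σ] H)
    {X Y X' Y' : Gr k H} (h : Adjacent X Y) (hX : X'.1 = X.1.map L.toLinearMap)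
    (hY : Y'.1 = Y.1.map L.toLinearMap) : Adjacent X' Y' := by
  unfold Adjacent at *
  rw [hX, hY, ← Submodule.map_inf _ L.injective, finrank_map_isometry, h]

theorem IsOrthoMap.exists_isometry {k : ℕ} {F : Submodule ℂ H → Submodule ℂ H}
    (hF : IsOrthoMap k F) (hk : 2 ≤ k) (hdim : ((2 * k : ℕ) : Cardinal) < Module.rank ℂ H) :
    ∃ σ : ℂ →+* ℂ, (σ = RingHom.id ℂ ∨ σ = starRingEnd ℂ) ∧
      ∃ L : H →ₛₗᵢ[σ] H, ∀ X : Submodule ℂ H, Module.finrank ℂ X = k → ∀ v ∈ X, L v ∈ F X := by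
  have hdim4 : ((4 : ℕ) : Cardinal) < Module.rank ℂ H :=
    lt_of_le_of_lt (by exact_mod_cast (by omega)) hdim
  obtain ⟨G, hG, hGF⟩ := IsOrthoMap.exists_descent_to hk F hF hdim
  obtain ⟨γ, hγ, hγG⟩ := hG.exists_isRayMap hdim4
  obtain ⟨σ, hσ, L, hL⟩ := hγ.exists_isometry hdim4
  refine ⟨σ, hσ, L, fun X hX v hv => ?_⟩
  have : FiniteDimensional ℂ X := FiniteDimensional.of_finrank_pos (by omega)
  have hvX : (ℂ ∙ v) ≤ X := (Submodule.span_singleton_le_iff_mem _ _).2 hv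
  have hv1 := (finrank_span_le_card (R := ℂ) ({v} : Set H)).trans_eq (by simp : _ = 1)
  -- A plane through v inside X links the map of lines to `F X`; the line is allowed to be zero.
  obtain ⟨Y, hvY, hYX, hY⟩ := exists_finrank_eq_between hvX (m := 2) (by omega) (by omega)
  obtain ⟨d, hd⟩ := hL v
  rw [hd]
  exact Submodule.smul_mem _ _ (hGF Y X hY hX hYX
    (hγG v Y hY ((Submodule.span_singleton_le_iff_mem _ _).1 hvY)))

open Classical in
/-- The extension of a transformation of the Grassmannian to all subspaces. -/
noncomputable def extendGr {k : ℕ} (f : Gr k H → Gr k H) (X : Submodule ℂ H) : Submodule ℂ H :=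
  if h : FiniteDimensional ℂ X ∧ Module.finrank ℂ X = k then (f ⟨X, h⟩).1 else ⊥

theorem extendGr_apply {k : ℕ} (f : Gr k H → Gr k H) (X : Gr k H) : extendGr f X.1 = (f X).1 :=
  dif_pos X.2

theorem isOrthoMap_extendGr [CompleteSpace H] {k : ℕ} (hk : 0 < k) {f : Gr k H → Gr k H}
    (hf : OrthogonalityPreserving f)
    (hadj : ∀ X Y : Gr k H, OrthoAdjacent X Y →
      k ≤ Module.finrank ℂ ((f X).1 ⊓ (f Y).1 : Submodule ℂ H) + 1) :
    IsOrthoMap k (extendGr f) := by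
  have lift : ∀ X : Submodule ℂ H, Module.finrank ℂ X = k → ∃ Z : Gr k H, Z.1 = X := fun X hX =>
    ⟨⟨X, FiniteDimensional.of_finrank_pos (by omega), hX⟩, rfl⟩
  refine ⟨?_, ?_, ?_⟩
  · intro X hX
    obtain ⟨X, rfl⟩ := lift X hX
    rw [extendGr_apply]
    exact (f X).2.2
  · intro X Y hX hY hXY
    obtain ⟨X, rfl⟩ := lift X hX
    obtain ⟨Y, rfl⟩ := lift Y hY
    rw [extendGr_apply, extendGr_apply]
    exact hf X Y hXY
  · intro S a b _ hS ha0 hb0 ha hb hab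
    have hXa := (finrank_sup_span_singleton ha0 ha).trans hS
    have hXb := (finrank_sup_span_singleton hb0 hb).trans hS
    obtain ⟨X, hX⟩ := lift _ hXa
    obtain ⟨Y, hY⟩ := lift _ hXb
    rw [← hX, ← hY, extendGr_apply, extendGr_apply]
    refine hadj X Y ⟨?_, ?_⟩
    · have h1 := Submodule.finrank_sup_add_finrank_inf_eq (S ⊔ ℂ ∙ a) (S ⊔ ℂ ∙ b)
      rw [show (S ⊔ ℂ ∙ a) ⊔ (S ⊔ ℂ ∙ b) = S ⊔ ℂ ∙ a ⊔ ℂ ∙ b by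
        rw [← sup_sup_distrib_left, sup_assoc], finrank_sup_span_singleton hb0
          (mem_orthogonal_sup_span_singleton.2 ⟨hb, hab⟩), hXa, hXb] at h1
      unfold Adjacent
      rw [hX, hY]
      omega
    · rw [hX, hY]
      exact compatible_sup_span_singleton ha0 hb0 ha hb hab

theorem eq_map_of_forall_mem {k : ℕ} {σ : ℂ →+* ℂ} [RingHomSurjective σ] {f : Gr k H → Gr k H}
    {L : H →ₛₗᵢ[σ] H}
    (h : ∀ X : Submodule ℂ H, Module.finrank ℂ X = k → ∀ v ∈ X, L v ∈ extendGr f X) (X : Gr k H) :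
    (f X).1 = X.1.map L.toLinearMap := by
  have := (f X).2.1
  refine (Submodule.eq_of_le_of_finrank_eq ?_ ?_).symm
  · rintro _ ⟨v, hv, rfl⟩
    rw [← extendGr_apply]
    exact h X.1 X.2.2 v hv
  · rw [finrank_map_isometry, X.2.2, (f X).2.2]

/-- The hypothesis `hadj` is a common weakening of conditions (A) and (B), so one argument serves
both. -/
theorem induced_of_orthoAdjacent [CompleteSpace H] {k : ℕ} (hk : 2 ≤ k)
    (hdim : ((2 * k : ℕ) : Cardinal) < Module.rank ℂ H) {f : Gr k H → Gr k H}
    (hf : OrthogonalityPreserving f)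
    (hadj : ∀ X Y : Gr k H, OrthoAdjacent X Y → Adjacent (f X) (f Y) ∨ f X = f Y) :
    InducedByLinearIsometry f ∨ InducedByConjLinearIsometry f := by
  obtain ⟨σ, hσ, L, hL⟩ := (isOrthoMap_extendGr (by omega) hf fun X Y hXY => by
    rcases hadj X Y hXY with h | h
    · exact h.ge
    · rw [h, inf_idem, (f Y).2.2]
      omega).exists_isometry hk hdim
  rcases hσ with rfl | rfl
  · exact Or.inl ⟨L, eq_map_of_forall_mem hL⟩
  · exact Or.inr ⟨L, eq_map_of_forall_mem hL⟩

end Induced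

end HilbertGrassmannian

theorem theorem3 {H : Type*} [NormedAddCommGroup H] [InnerProductSpace ℂ H] [CompleteSpace H]
    (k : ℕ) (hk : 2 < 2 * k) (hdim : ((2 * k : ℕ) : Cardinal) < Module.rank ℂ H)
    (f : HilbertGrassmannian.Gr k H → HilbertGrassmannian.Gr k H)
    (hf : HilbertGrassmannian.OrthogonalityPreserving f) :
    (HilbertGrassmannian.OrthoAdjacencyPreserving f ↔
      ∀ X Y : HilbertGrassmannian.Gr k H, HilbertGrassmannian.Adjacent X Y →
        HilbertGrassmannian.Adjacent (f X) (f Y) ∨ f X = f Y) ∧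
    ((HilbertGrassmannian.OrthoAdjacencyPreserving f ∨
      ∀ X Y : HilbertGrassmannian.Gr k H, HilbertGrassmannian.Adjacent X Y →
        HilbertGrassmannian.Adjacent (f X) (f Y) ∨ f X = f Y) →
      HilbertGrassmannian.InducedByLinearIsometry f ∨
        HilbertGrassmannian.InducedByConjLinearIsometry f) := by
  have hk' : 2 ≤ k := by omega
  have hA := fun h : HilbertGrassmannian.OrthoAdjacencyPreserving f =>
    HilbertGrassmannian.induced_of_orthoAdjacent hk' hdim hf
      fun X Y hXY => Or.inl (h X Y hXY).1
  have hB := fun h : ∀ X Y : HilbertGrassmannian.Gr k H, HilbertGrassmannian.Adjacent X Y →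
      HilbertGrassmannian.Adjacent (f X) (f Y) ∨ f X = f Y =>
    HilbertGrassmannian.induced_of_orthoAdjacent hk' hdim hf fun X Y hXY => h X Y hXY.1
  refine ⟨⟨fun h X Y hXY => Or.inl ?_, fun h X Y hXY => ?_⟩, fun h => h.elim hA hB⟩
  · rcases hA h with ⟨L, hL⟩ | ⟨L, hL⟩
    · exact HilbertGrassmannian.adjacent_of_map L hXY (hL X) (hL Y)
    · exact HilbertGrassmannian.adjacent_of_map L hXY (hL X) (hL Y)
  · rcases hB h with ⟨L, hL⟩ | ⟨L, hL⟩
    · exact HilbertGrassmannian.orthoAdjacent_of_map L hXY (hL X) (hL Y)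
    · exact HilbertGrassmannian.orthoAdjacent_of_map L hXY (hL X) (hL Y)
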